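/- Let $\mathbb T=\mathbb R\cup\{\infty\}$ be the tropical semifield (addition $\min=\wedge$, multiplication $+$), with the order topology. Let $K$ be a field with a non-archimedean valuation $\nu:K\to\mathbb R\cup\{\infty\}$ whose residue field is infinite. Let $f=(f_1,\dots,f_d):(\mathbb T^d,\infty)\to(\mathbb T^d,\infty)$ be a convergent tropical germ, i.e. each $f_i(x)=\bigwedge_{I\in\mathbb N^d}(f_{i,I}+\langle I,x\rangle)$ is a formal tropical power series with constant coefficient $\infty$ which on some neighbourhood of $\infty=(\infty,\dots,\infty)$ is determined by finitely many of its monomials. Assume that all coefficients $f_{i,I}$ lie in $\nu(K)$ (no condition if the value group of $\nu$ is $\mathbb R$). Let $A=(a_{ij})$ be the matrix of the linear part of $f$: $a_{ij}\in\mathbb T$ is the coefficient of $x_j$ in $f_i$. Definitions. * A germ $g$ of a map at a fixed point $p$ is *contracting* if every neighbourhood $U$ of $p$ contains an open neighbourhood $V$ of $p$ such that $g$ is defined on $V$ and $g(V)$ is relatively compact in $V$ (its closure is compact and contained in $V$). This is used for $f$ on $\mathbb T^d$ at $\infty$, and for analytic germs $(\mathbb A^d_K,0)\to(\mathbb A^d_K,0)$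 on the Berkovich analytification of $\mathbb A^d_K$ (multiplicative seminorms on $K[x_1,\dots,x_d]$ extending $|\cdot|=e^{-\nu}$, with the topology of pointwise convergence) at the origin. * The *tropical eigenvalues* of $A$ are the $\lambda\in\mathbb T$ in the corner locus of the tropical characteristic polynomial $P_A(\lambda)=\det_{\mathbb T}(A\wedge\lambda I)$, i.e. those at which the minimum defining $P_A(\lambda)$ is attained by at least two monomials in $\lambda$; here $\det_{\mathbb T}(B)=\bigwedge_{\sigma\in S_d}\sum_i b_{i,\sigma(i)}$. * A *lift* of $f$ is a $d$-tuple $F=(F_1,\dots,F_d)$ of power series over $K$, analytic at $0$, with $\nu(F_{i,I})=f_{i,I}$ for all $i$ and $I$. * A property holds for *generic lifts* of $f$ if there is a nonzero polynomial $Q$ over $K$ in finitely many of the coefficients $(i,I)$ with $f_{i,I}\ne\infty$, such that the property holds for every lift $F$ for which no cancellation of lowest order terms occurs in $Q$, i.e. for which the valuation of the value of $Q$ at the coefficients of $F$ equals the minimum of the valuations of its monomials there. Then the following four conditions are equivalent: (a) $f$ is contracting; (b) $\lambda>0$ for all tropical eigenvalues $\lambda$ of $A$; (c) generic lifts of $f$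 are contracting; (d) all lifts of $f$ are contracting. -/

import Mathlib

open Filter Topology

/-! ### Contracting germs of partial maps -/

/-- A partial map of a topological space `X`, given by its graph `R` (`R x y` means that the map is
defined at `x` with value `y`), is contracting at `p` if every neighbourhood `U` of `p` contains an
open neighbourhood `V` of `p` such that the map is defined on `V` and sends `V` onto a set which is
relatively compact inside `V`. -/
def IsContractingAt {X : Type*} [TopologicalSpace X] (R : X → X → Prop) (p : X) : Prop :=
  ∀ U ∈ 𝓝 p, ∃ V : Set X, V ⊆ U ∧ IsOpen V ∧ p ∈ V ∧ (∀ x ∈ V, ∃ y, R x y) ∧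
    IsCompact (closure {y | ∃ x ∈ V, R x y}) ∧ closure {y | ∃ x ∈ V, R x y} ⊆ V

/-! ### Tropical series and tropical germs

The tropical numbers `ℝ ∪ {∞}` are `WithTop ℝ`, with `min` as addition, `+` as multiplication and
the order topology, in which the sets `(a, ∞]` are the basic neighbourhoods of `∞`. -/

/-- A formal tropical power series `⋀_I (φ_I + ⟨I, x⟩)` in `d` variables, given by its
coefficients. -/
abbrev TropSeries (d : ℕ) : Type := (Fin d →₀ ℕ) → WithTop ℝ

namespace TropSeries

variable {d : ℕ}

/-- The value at `x` of the monomial of exponent `I` of `φ`, that is `φ_I + ⟨I, x⟩`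
(with `0 • ∞ = 0`). -/
def term (φ : TropSeries d) (x : Fin d → WithTop ℝ) (I : Fin d →₀ ℕ) : WithTop ℝ :=
  φ I + ∑ i, I i • x i

/-- `φ` is convergent at `∞`: on some neighbourhood of `∞` it is determined by finitely many of its
monomials. -/
def IsConvergent (φ : TropSeries d) : Prop :=
  ∃ U ∈ 𝓝 (fun _ : Fin d => (⊤ : WithTop ℝ)), ∃ S : Finset (Fin d →₀ ℕ),
    ∀ x ∈ U, ∀ I, S.inf (φ.term x) ≤ φ.term x I

end TropSeries

/-- `f = (f_1, …, f_d)` is a convergent tropical germ `(𝕋^d, ∞) → (𝕋^d, ∞)`: each component is a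
convergent series, and `f` fixes `∞`, i.e. the constant coefficients are `∞`. -/
def IsConvergentTropGerm {d : ℕ} (f : Fin d → TropSeries d) : Prop :=
  ∀ i, (f i).IsConvergent ∧ f i 0 = ⊤

/-- The graph of the partial map of `𝕋^d` defined by `f`: `y_i` is the infimum of the values at `x`
of the monomials of `f_i`. -/
def TropMapsTo {d : ℕ} (f : Fin d → TropSeries d) (x y : Fin d → WithTop ℝ) : Prop :=
  ∀ i, IsGLB (Set.range ((f i).term x)) (y i)

/-- The tropical germ `f` is contracting. -/
def IsContractingTropGerm {d : ℕ} (f : Fin d → TropSeries d) : Prop :=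
  IsContractingAt (TropMapsTo f) (fun _ => ⊤)

/-- The matrix of the linear part of `f`: its `(i, j)` entry is the coefficient of `x_j`
in `f_i`. -/
noncomputable def tropLinearPart {d : ℕ} (f : Fin d → TropSeries d) : Matrix (Fin d) (Fin d) (WithTop ℝ) :=
  Matrix.of fun i j => f i (Finsupp.single j 1)

/-! ### Tropical eigenvalues -/

/-- The tropical characteristic polynomial of `A`, i.e. the tropical determinant of `A ∧ X I`. The
tropical determinant `⋀_σ ∑_i a_{i, σ(i)}` is the permanent over the tropical semiring. -/
noncomputable def tropCharpoly {d : ℕ} (A : Matrix (Fin d) (Fin d) (WithTop ℝ)) :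
    Polynomial (Tropical (WithTop ℝ)) :=
  Matrix.permanent (Matrix.of fun i j =>
    Polynomial.C (Tropical.trop (A i j)) + if i = j then Polynomial.X else 0)

/-- `l` is a tropical eigenvalue of `A`: it lies in the corner locus of the tropical characteristic
polynomial, i.e. the minimum in the value of this polynomial at `l` is attained by at least two
monomials. -/
def IsTropEigenvalue {d : ℕ} (A : Matrix (Fin d) (Fin d) (WithTop ℝ)) (l : WithTop ℝ) : Prop :=
  ∃ k m : ℕ, k ≠ m ∧
    (tropCharpoly A).coeff k * Tropical.trop l ^ k = (tropCharpoly A).eval (Tropical.trop l) ∧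
    (tropCharpoly A).coeff m * Tropical.trop l ^ m = (tropCharpoly A).eval (Tropical.trop l)

/-! ### Analytic germs over a valued field

`K` is a field with a non-archimedean valuation `ν : K → ℝ ∪ {∞}`, with norm `|a| = e^{-ν(a)}`. -/

/-- The power series `g` is analytic at `0`: `ν(g_I) + a |I| → ∞` for some real `a`, i.e.
`|g_I| α^{|I|} → 0` for `α = e^{-a} > 0`. -/
def IsAnalyticSeries {K : Type*} [Field K] (ν : AddValuation K (WithTop ℝ)) {d : ℕ}
    (g : MvPowerSeries (Fin d) K) : Prop :=
  ∃ a : ℝ, Tendsto (fun I : Fin d →₀ ℕ =>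
    ν (MvPowerSeries.coeff I g) + ((a * (I.degree : ℝ) : ℝ) : WithTop ℝ)) cofinite (𝓝 ⊤)

/-- The analytification (in the sense of Berkovich) of the affine space `𝔸^d` over `K`: its points
are the multiplicative seminorms on `K[x_1, …, x_d]` that extend the norm of `K`. A seminorm is
recorded additively, by `w = -log |·|`; since the norm of `K` is non-archimedean, so are all these
seminorms. -/
structure BerkovichAffine {K : Type*} [Field K] (ν : AddValuation K (WithTop ℝ)) (d : ℕ) where
  val : AddValuation (MvPolynomial (Fin d) K) (WithTop ℝ)
  val_C : ∀ a : K, val (MvPolynomial.C a) = ν a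

namespace BerkovichAffine

variable {K : Type*} [Field K] {ν : AddValuation K (WithTop ℝ)} {d : ℕ}

/-- The coarsest topology for which `w ↦ w(P)` is continuous for every polynomial `P`. -/
noncomputable instance : TopologicalSpace (BerkovichAffine ν d) :=
  TopologicalSpace.induced (fun w (P : MvPolynomial (Fin d) K) => w.val P) inferInstance

/-- The origin of `𝔸^d`, as the seminorm `P ↦ |P(0)|`. -/
noncomputable def origin (ν : AddValuation K (WithTop ℝ)) (d : ℕ) : BerkovichAffine ν d where
  val := ν.comap (MvPolynomial.constantCoeff)
  val_C a := congrArg ν (MvPolynomial.constantCoeff_C (Fin d) a)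

/-- The seminorm `w` has a value `v` on the power series `g`: the values of `w` on the finite
truncations of `g` converge to `v`. -/
def HasSeriesValue (w : BerkovichAffine ν d) (g : MvPowerSeries (Fin d) K) (v : WithTop ℝ) : Prop :=
  Tendsto (fun S : Finset (Fin d →₀ ℕ) =>
    w.val (∑ I ∈ S, MvPolynomial.monomial I (MvPowerSeries.coeff I g))) atTop (𝓝 v)

/-- The graph of the partial map of the analytification of `𝔸^d` induced by power series
`F = (F_1, …, F_d)`: the image of `w` is the seminorm `P ↦ w(P ∘ F)`. -/
def MapsTo (F : Fin d → MvPowerSeries (Fin d) K) (w w' : BerkovichAffine ν d) : Prop :=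
  ∀ P : MvPolynomial (Fin d) K, w.HasSeriesValue (MvPolynomial.aeval F P) (w'.val P)

end BerkovichAffine

/-- The analytic germ `F : (𝔸^d, 0) → (𝔸^d, 0)` is contracting. -/
def IsContractingAnalyticGerm {K : Type*} [Field K] (ν : AddValuation K (WithTop ℝ)) {d : ℕ}
    (F : Fin d → MvPowerSeries (Fin d) K) : Prop :=
  IsContractingAt (BerkovichAffine.MapsTo (ν := ν) F) (BerkovichAffine.origin ν d)

/-! ### Lifts and generic lifts -/

/-- `F` is a lift of `f`: an analytic germ whose tropicalization is `f`. (If `f` fixes `∞` then `F`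
fixes `0`.) -/
def IsLift {K : Type*} [Field K] (ν : AddValuation K (WithTop ℝ)) {d : ℕ}
    (f : Fin d → TropSeries d) (F : Fin d → MvPowerSeries (Fin d) K) : Prop :=
  ∀ i, IsAnalyticSeries ν (F i) ∧ ∀ I, ν (MvPowerSeries.coeff I (F i)) = f i I

/-- The pairs `(i, I)` such that the coefficient of exponent `I` of `f_i` is not `∞`; the
corresponding coefficients of the lifts of `f` are the nonzero ones. -/
abbrev TropSupport {d : ℕ} (f : Fin d → TropSeries d) : Type :=
  {p : Fin d × (Fin d →₀ ℕ) // f p.1 p.2 ≠ ⊤}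

/-- There is no cancellation of lowest order terms in the value of the polynomial `Q` at `c`:
`ν(Q(c))` is the minimum of the valuations of the monomials of `Q` at `c`, that is, the value of the
tropicalization of `Q` at `ν(c)`. -/
def NoCancellation {K : Type*} [Field K] (ν : AddValuation K (WithTop ℝ)) {σ : Type*}
    (Q : MvPolynomial σ K) (c : σ → K) : Prop :=
  ν (MvPolynomial.eval c Q) =
    Q.support.inf fun m => ν (Q.coeff m) + m.sum fun p n => n • ν (c p)

/-- A property `p` holds for generic lifts of `f`: there is a nonzero polynomial `Q` in (finitely
many of) the coefficients such that `p` holds for all lifts of `f` for which no cancellation of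
lowest order terms occurs in `Q`. After normalizing the coefficients of the lifts to units, these
conditions are the ones that the reductions of the units lie in a given nonempty Zariski open subset
of a torus over the residue field. -/
def ForGenericLifts {K : Type*} [Field K] (ν : AddValuation K (WithTop ℝ)) {d : ℕ}
    (f : Fin d → TropSeries d) (p : (Fin d → MvPowerSeries (Fin d) K) → Prop) : Prop :=
  ∃ Q : MvPolynomial (TropSupport f) K, Q ≠ 0 ∧ ∀ F, IsLift ν f F →
    NoCancellation ν Q (fun s => MvPowerSeries.coeff s.1.2 (F s.1.1)) → p F

/-! All four conditions are compared with a fifth: every system of cycles in the weighted graph of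
`A` has positive weight. The coefficient of `λ^(d-k)` in `P_A` is the least weight of a system of
disjoint cycles covering `k` vertices, and the coefficient of `λ^d` is `0`. So a nonpositive weight
produces a nonpositive slope of the Newton polygon, and conversely (`tropEigenvalues_pos_iff`).

If all cycles are positive, shortest paths give real weights `p` and `ε > 0` with `p_i + ε ≤ a_ij +
p_j` (`exists_strict_potential`). Near `∞` the terms of degree at least two are negligible, so `f`
sends the box `x_i > p_i + r` into the compact box `x_i ≥ p_i + r + ε` (`term_ge_of_potential`). The
same estimate on polydiscs makes every lift contracting, with no genericity needed.

Conversely, suppose a system of cycles on `T` has weight at most `0`. Then `f` does not increase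
`∑_{i ∈ T} x_i`, which contradicts the existence of a minimum of this sum on a compact image closure
inside an open set (`cycleWeight_pos_of_isContractingTropGerm`). For lifts, the infinite residue
field provides a lift that avoids cancellation both in `Q` and in a coefficient of the
characteristic polynomial of the linear part; that coefficient then has valuation at most `0`
(`exists_generic_lift`). By `le_val_charpoly_coeff`, the powers of the linear part keep entries of
small valuation, which bounds how close to the origin the iterates of a Gauss point can come
(`val_X_iterate_le`).

If some weight is negative, these iterates leave a fixed polydisc
(`not_isContracting_of_charpoly_neg`). If the least weight is `0`, potentials with `ε = 0` give
stable polydiscs of all small radii. The ultrafilter limits of the orbits of their Gauss points are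
concave, hence continuous, in the logarithmic radius. This connected curve enters any attracted
neighbourhood `V`, cannot leave it, and yet has a point outside it
(`not_isContracting_of_charpoly_nonpos`). -/

namespace WithTop

/-! ### Topology of the tropical numbers. -/

lemma exists_real_lt (x : WithTop ℝ) : ∃ m : ℝ, (m : WithTop ℝ) < x := by
  induction x with
  | top => exact ⟨0, WithTop.coe_lt_top 0⟩
  | coe a => exact ⟨a - 1, by exact_mod_cast sub_one_lt a⟩

lemma le_of_forall_real_le {x y : WithTop ℝ}
    (h : ∀ m : ℝ, (m : WithTop ℝ) ≤ x → (m : WithTop ℝ) ≤ y) : x ≤ y := by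
  induction x with
  | top =>
    induction y with
    | top => exact le_rfl
    | coe b =>
      have := h (b + 1) le_top
      norm_cast at this
      linarith
  | coe a => exact h a le_rfl

lemma tendsto_nhds_top_real {α : Type*} {l : Filter α} {u : α → WithTop ℝ} :
    Tendsto u l (𝓝 ⊤) ↔ ∀ m : ℝ, ∀ᶠ x in l, (m : WithTop ℝ) ≤ u x := by
  rw [tendsto_order]
  constructor
  · rintro ⟨h, -⟩ m
    exact (h m (coe_lt_top m)).mono fun _ => le_of_lt
  · intro h
    refine ⟨fun a ha => ?_, fun a ha => absurd ha (by simp)⟩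
    lift a to ℝ using ha.ne
    filter_upwards [h (a + 1)] with x hx
    exact lt_of_lt_of_le (by exact_mod_cast lt_add_one a) hx

lemma tendsto_add_nhds (a b : WithTop ℝ) :
    Tendsto (fun p : WithTop ℝ × WithTop ℝ => p.1 + p.2) (𝓝 (a, b)) (𝓝 (a + b)) := by
  have top_case : ∀ (b : WithTop ℝ),
      Tendsto (fun p : WithTop ℝ × WithTop ℝ => p.1 + p.2) (𝓝 (⊤, b)) (𝓝 (⊤ + b)) := by
    intro b
    rw [WithTop.top_add, tendsto_nhds_top_real]
    intro m
    obtain ⟨k, hk⟩ := exists_real_lt b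
    have h1 : ∀ᶠ p : WithTop ℝ × WithTop ℝ in 𝓝 (⊤, b), ((m - k : ℝ) : WithTop ℝ) < p.1 :=
      continuous_fst.continuousAt.eventually (lt_mem_nhds (coe_lt_top _))
    have h2 : ∀ᶠ p : WithTop ℝ × WithTop ℝ in 𝓝 (⊤, b), (k : WithTop ℝ) < p.2 :=
      continuous_snd.continuousAt.eventually (lt_mem_nhds hk)
    filter_upwards [h1, h2] with p hp1 hp2
    calc (m : WithTop ℝ) = ((m - k : ℝ) : WithTop ℝ) + (k : WithTop ℝ) := by
          norm_cast; ring
      _ ≤ _ := add_le_add hp1.le hp2.le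
  induction a with
  | top => exact top_case b
  | coe a =>
    induction b with
    | top =>
      have := (top_case (a : WithTop ℝ)).comp
        (continuous_swap.tendsto ((a : WithTop ℝ), (⊤ : WithTop ℝ)))
      rw [add_comm]
      refine this.congr fun p => ?_
      simp [add_comm]
    | coe b =>
      have h : IsOpenEmbedding (Prod.map ((↑) : ℝ → WithTop ℝ) ((↑) : ℝ → WithTop ℝ)) :=
        isOpenEmbedding_coe.prodMap isOpenEmbedding_coe
      have := h.map_nhds_eq (a, b)
      simp only [Prod.map_apply] at this
      rw [← this, tendsto_map'_iff]
      have h2 : Tendsto (fun p : ℝ × ℝ => ((p.1 + p.2 : ℝ) : WithTop ℝ)) (𝓝 (a, b))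
          (𝓝 ((a + b : ℝ) : WithTop ℝ)) :=
        (isOpenEmbedding_coe.continuous.comp continuous_add).tendsto (a, b)
      exact h2

instance continuousAddReal : ContinuousAdd (WithTop ℝ) :=
  ⟨continuous_iff_continuousAt.2 fun p => tendsto_add_nhds p.1 p.2⟩

/-- An ultrafilter on this ray either contains a bounded real interval, which is compact, or it
eventually exceeds every real number and converges to `∞`. -/
lemma isCompact_Ici_coe (m : WithTop ℝ) : IsCompact (Set.Ici m) := by
  rw [isCompact_iff_ultrafilter_le_nhds]
  intro 𝒰 h𝒰
  rw [le_principal_iff] at h𝒰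
  by_cases hb : ∃ M : ℝ, ∀ᶠ x in (𝒰 : Filter (WithTop ℝ)), x ≤ (M : WithTop ℝ)
  · obtain ⟨M, hM⟩ := hb
    obtain ⟨x0, hx0⟩ := (hM.and h𝒰).exists
    have hm : m ≠ ⊤ := fun h => by
      have := (show m ≤ x0 from hx0.2).trans hx0.1
      simp [h] at this
    lift m to ℝ using hm
    have hc : IsCompact (((↑) : ℝ → WithTop ℝ) '' Set.Icc m M) :=
      isCompact_Icc.image isOpenEmbedding_coe.continuous
    have hs : ((↑) : ℝ → WithTop ℝ) '' Set.Icc m M ∈ (𝒰 : Filter (WithTop ℝ)) := by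
      filter_upwards [hM, h𝒰] with x hx1 hx2
      lift x to ℝ using (ne_top_of_le_ne_top coe_ne_top hx1)
      exact ⟨x, ⟨by exact_mod_cast (show (m : WithTop ℝ) ≤ x from hx2), by exact_mod_cast hx1⟩, rfl⟩
    obtain ⟨x, hx, hle⟩ := isCompact_iff_ultrafilter_le_nhds.1 hc 𝒰 (le_principal_iff.2 hs)
    obtain ⟨y, hy, rfl⟩ := hx
    exact ⟨_, by simpa using hy.1, hle⟩
  · refine ⟨⊤, Set.mem_Ici.2 le_top, ?_⟩
    have : Tendsto (fun x : WithTop ℝ => x) (𝒰 : Filter (WithTop ℝ)) (𝓝 ⊤) := by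
      rw [tendsto_nhds_top_real]
      intro M
      filter_upwards [Ultrafilter.eventually_not.2 (not_exists.1 hb M)] with x hx
      exact (not_le.1 hx).le
    exact this

lemma nhds_pi_top_basis {ι : Type*} [Finite ι] {U : Set (ι → WithTop ℝ)}
    (hU : U ∈ 𝓝 (fun _ : ι => (⊤ : WithTop ℝ))) :
    ∃ t : ℝ, ∀ x : ι → WithTop ℝ, (∀ i, (t : WithTop ℝ) ≤ x i) → x ∈ U := by
  cases nonempty_fintype ι
  rw [nhds_pi, mem_pi'] at hU
  obtain ⟨I, s, hs, hsU⟩ := hU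
  have h1 : ∀ i, ∃ t : ℝ, ∀ y : WithTop ℝ, (t : WithTop ℝ) ≤ y → y ∈ s i := by
    intro i
    by_contra hcon
    push Not at hcon
    choose y hy hys using hcon
    have : Tendsto y atTop (𝓝 (⊤ : WithTop ℝ)) := by
      rw [tendsto_nhds_top_real]
      intro m
      filter_upwards [eventually_ge_atTop m] with k hk
      exact le_trans (by exact_mod_cast hk) (hy k)
    obtain ⟨k, hk⟩ := (this.eventually (hs i)).exists
    exact hys k hk
  choose t ht using h1
  refine ⟨∑ i, |t i|, fun x hx => hsU fun i _ => ht i _ (le_trans ?_ (hx i))⟩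
  have : t i ≤ ∑ i, |t i| := (le_abs_self _).trans
    (Finset.single_le_sum (f := fun i => |t i|) (fun i _ => abs_nonneg _) (Finset.mem_univ i))
  exact_mod_cast this

lemma isOpen_box {ι : Type*} [Finite ι] (t : ι → ℝ) :
    IsOpen {x : ι → WithTop ℝ | ∀ i, (t i : WithTop ℝ) < x i} := by
  simp only [Set.ofPred_forall]
  exact isOpen_iInter_of_finite fun i => isOpen_lt continuous_const (continuous_apply i)

end WithTop

/-! ### Cycle weights and shortest-path potentials. -/

section CycleCovers

variable {ι : Type*}

/-- The weight of the path through the vertices in a list. -/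
def pathWeight (a : ι → ι → WithTop ℝ) (l : List ι) : WithTop ℝ :=
  (List.zipWith a l l.tail).sum

lemma pathWeight_append (a : ι → ι → WithTop ℝ) (l₁ l₂ : List ι) (i : ι) :
    pathWeight a (l₁ ++ i :: l₂) = pathWeight a (l₁ ++ [i]) + pathWeight a (i :: l₂) := by
  induction l₁ with
  | nil => simp [pathWeight]
  | cons x l ih =>
    cases l with
    | nil => simp [pathWeight]
    | cons y l =>
      have h1 : ∀ m, pathWeight a (x :: y :: l ++ m) = a x y + pathWeight a (y :: l ++ m) := by
        intro m; simp [pathWeight]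
      rw [h1, h1, ih, add_assoc]

/-- The weight `∑_{i ∈ T} a_{τ(i), i}`. If `τ` fixes all points outside `T`, this is the total weight
of the cycles of `τ` on `T` in the graph with an edge `i → j` of weight `a_{ij}` for all `i`, `j`. -/
def cycleWeight (a : ι → ι → WithTop ℝ) (τ : Equiv.Perm ι) (T : Finset ι) : WithTop ℝ :=
  ∑ i ∈ T, a (τ i) i

variable [DecidableEq ι]

/-- `List.formPerm` sends each vertex to its successor. The inverse appears because `cycleWeight`
uses the edges from `τ i` to `i`. -/
lemma pathWeight_cycle (a : ι → ι → WithTop ℝ) (i : ι) (l : List ι) (h : (i :: l).Nodup) :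
    pathWeight a (i :: l ++ [i]) =
      cycleWeight a (i :: l).formPerm⁻¹ (i :: l).toFinset := by
  set c := i :: l with hc
  have h1 : c.map c.formPerm = l ++ [i] := by
    have : c.map c.formPerm = c.rotate 1 := by
      refine List.ext_getElem (by simp) fun n h1 h2 => ?_
      rw [List.getElem_map, List.formPerm_apply_getElem _ h, List.getElem_rotate]
    rw [this, hc]; simp
  have h2 : pathWeight a (c ++ [i]) = (c.map fun x => a x (c.formPerm x)).sum := by
    unfold pathWeight
    have h3 : (c ++ [i]).tail = c.map c.formPerm ++ [] := by rw [h1, hc]; simp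
    rw [h3, List.zipWith_append (by simp)]
    simp [List.zipWith_map_right, List.zipWith_self]
  have hm : ∀ x, c.formPerm⁻¹ x ∈ c.toFinset ↔ x ∈ c.toFinset := by
    intro x
    rw [List.mem_toFinset, List.mem_toFinset, ← List.formPerm_mem_iff_mem (l := c)]
    simp
  rw [h2, cycleWeight, ← List.sum_toFinset _ h]
  refine Finset.sum_equiv c.formPerm (fun x => ?_) (fun x _ => by simp)
  rw [← hm (c.formPerm x)]; simp

/-- The potential at `i` is the least weight of a simple path starting at `i` with free end. Absence
of negative cycles means that repeating a vertex never pays. The one-vertex path keeps the minimum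
finite. -/
lemma exists_potential [Fintype ι] (a : ι → ι → WithTop ℝ)
    (h : ∀ (τ : Equiv.Perm ι) (T : Finset ι), (∀ i ∉ T, τ i = i) → 0 ≤ cycleWeight a τ T) :
    ∃ p : ι → ℝ, ∀ i j, (p i : WithTop ℝ) ≤ a i j + p j := by
  classical
  let S : ι → Finset {l : List ι // l.Nodup} := fun i => Finset.univ.filter fun l => l.1.head? = some i
  let q : ι → WithTop ℝ := fun i => (S i).inf fun l => pathWeight a l.1
  have hq0 : ∀ i, q i ≤ 0 := fun i => by
    have : (⟨[i], List.nodup_singleton i⟩ : {l : List ι // l.Nodup}) ∈ S i := by simp [S]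
    refine (Finset.inf_le this).trans ?_
    simp [pathWeight]
  have hqt : ∀ i, q i ≠ ⊤ := fun i => ne_top_of_le_ne_top (by simp) (hq0 i)
  refine ⟨fun i => (q i).untop (hqt i), fun i j => ?_⟩
  simp only [WithTop.coe_untop]
  have hne : (S j).Nonempty := ⟨⟨[j], List.nodup_singleton j⟩, by simp [S]⟩
  obtain ⟨⟨l, hl⟩, hlS, hlq⟩ := Finset.exists_mem_eq_inf (S j) hne fun l => pathWeight a l.1
  have hhead : l.head? = some j := by simpa [S] using hlS
  obtain ⟨l', rfl⟩ : ∃ l', l = j :: l' := by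
    cases l with
    | nil => simp at hhead
    | cons x l' => simp at hhead; exact ⟨l', by rw [hhead]⟩
  have hcons : pathWeight a (i :: j :: l') = a i j + q j := by
    change _ = _ + (S j).inf _
    rw [hlq]; simp [pathWeight]
  rw [← hcons]
  -- If the optimal path from `j` already meets `i`, prepending `i` closes a simple cycle. Dropping
  -- this cycle of nonnegative weight leaves a simple path from `i`.
  by_cases hi : i ∈ j :: l'
  · obtain ⟨l₁, l₂, hl12⟩ := List.append_of_mem hi
    rw [hl12] at hl ⊢
    have hn1 : (i :: l₁).Nodup := by
      have h1 := hl.of_append_left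
      rw [List.nodup_cons]
      refine ⟨fun hmem => ?_, h1⟩
      have := List.disjoint_of_nodup_append hl hmem
      simp at this
    have hn2 : (i :: l₂).Nodup := hl.of_append_right
    rw [← List.cons_append, pathWeight_append, pathWeight_cycle a i l₁ hn1]
    have h2 : q i ≤ pathWeight a (i :: l₂) :=
      Finset.inf_le (s := S i) (f := fun l => pathWeight a l.1) (b := ⟨i :: l₂, hn2⟩) (by simp [S])
    refine h2.trans (le_add_of_nonneg_left (h _ _ fun x hx => ?_))
    rw [Equiv.Perm.inv_eq_iff_eq]
    exact (List.formPerm_apply_of_notMem (by simpa using hx)).symm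
  · exact Finset.inf_le (s := S i) (f := fun l => pathWeight a l.1)
      (b := ⟨i :: j :: l', List.nodup_cons.2 ⟨hi, hl⟩⟩) (by simp [S])

/-- There are finitely many cycle systems, so their weights have a common positive lower bound `δ`.
Lowering every edge by a small enough fraction of `δ` keeps all cycles nonnegative, and the amount
lowered becomes the gain. -/
lemma exists_strict_potential [Fintype ι] (a : ι → ι → WithTop ℝ)
    (h : ∀ (τ : Equiv.Perm ι) (T : Finset ι), (∀ i ∉ T, τ i = i) → T.Nonempty →
      0 < cycleWeight a τ T) :
    ∃ (p : ι → ℝ) (ε : ℝ), 0 < ε ∧ ∀ i j, ((p i + ε : ℝ) : WithTop ℝ) ≤ a i j + p j := by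
  classical
  obtain ⟨δ, hδ, hδW⟩ : ∃ δ : ℝ, 0 < δ ∧ ∀ (τ : Equiv.Perm ι) (T : Finset ι), (∀ i ∉ T, τ i = i) →
      T.Nonempty → (δ : WithTop ℝ) ≤ cycleWeight a τ T := by
    let S : Finset (Equiv.Perm ι × Finset ι) :=
      Finset.univ.filter fun x => (∀ i ∉ x.2, x.1 i = i) ∧ x.2.Nonempty
    -- The cap at `1` makes `δ` real even if all weights are `∞` or there are no cycles.
    have h0 : (0 : WithTop ℝ) < min 1 (S.inf fun x => cycleWeight a x.1 x.2) := by
      refine lt_min (by norm_num) ((Finset.lt_inf_iff (by simp)).2 fun x hx => ?_)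
      simp only [S, Finset.mem_filter, Finset.mem_univ, true_and] at hx
      exact h _ _ hx.1 hx.2
    obtain ⟨δ, hδ⟩ := WithTop.ne_top_iff_exists.1
      (ne_top_of_le_ne_top (WithTop.one_ne_top (α := ℝ)) (min_le_left 1 (S.inf fun x => cycleWeight a x.1 x.2)))
    refine ⟨δ, ?_, fun τ T h1 h2 => ?_⟩
    · rw [← hδ] at h0; exact_mod_cast h0
    · rw [hδ]
      exact (min_le_right _ _).trans (Finset.inf_le (f := fun x => cycleWeight a x.1 x.2) (b := (τ, T))
        (by simp only [S, Finset.mem_filter, Finset.mem_univ, true_and]; exact ⟨h1, h2⟩))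
  -- This exceeds the number of edges in any cycle system and is nonzero also for empty `ι`.
  set n : ℝ := Fintype.card ι + 1 with hn
  have hnpos : 0 < n := by positivity
  obtain ⟨p, hp⟩ := exists_potential (fun i j => a i j + ((-(δ / n) : ℝ) : WithTop ℝ)) (by
    intro τ T hT
    rcases T.eq_empty_or_nonempty with rfl | hne
    · simp [cycleWeight]
    have h1 := hδW τ T hT hne
    have h2 : cycleWeight (fun i j => a i j + ((-(δ / n) : ℝ) : WithTop ℝ)) τ T =
        cycleWeight a τ T + ((T.card * (-(δ / n)) : ℝ) : WithTop ℝ) := by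
      unfold cycleWeight
      rw [Finset.sum_add_distrib, Finset.sum_const, ← WithTop.coe_nsmul, nsmul_eq_mul]
    rw [h2]
    have h3 : (T.card : ℝ) ≤ n := by
      have := Finset.card_le_univ T
      rw [hn]; exact_mod_cast this.trans (Nat.le_succ _)
    have h4 : 0 ≤ δ + T.card * (-(δ / n)) := by
      have : T.card * (δ / n) ≤ n * (δ / n) := by gcongr
      rw [mul_div_cancel₀ _ hnpos.ne'] at this
      linarith
    calc (0 : WithTop ℝ) ≤ ((δ + T.card * (-(δ / n)) : ℝ) : WithTop ℝ) := by exact_mod_cast h4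
      _ ≤ _ := by rw [WithTop.coe_add]; gcongr)
  refine ⟨p, δ / n, by positivity, fun i j => ?_⟩
  have := add_le_add_left (hp i j) ((δ / n : ℝ) : WithTop ℝ)
  rw [← WithTop.coe_add] at this
  refine this.trans_eq ?_
  rw [add_right_comm, add_assoc (a i j), ← WithTop.coe_add]
  simp

lemma perm_mem_iff_of_fixes {τ : Equiv.Perm ι} {T : Finset ι} (hT : ∀ i ∉ T, τ i = i) (i : ι) :
    τ i ∈ T ↔ i ∈ T := by
  by_cases h : i ∈ T
  · refine ⟨fun _ => h, fun _ => ?_⟩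
    by_contra h2
    have := hT _ h2
    rw [τ.injective this] at h2
    exact h2 h
  · rw [hT i h]

lemma sum_perm_of_fixes {M : Type*} [AddCommMonoid M] {τ : Equiv.Perm ι} {T : Finset ι}
    (hT : ∀ i ∉ T, τ i = i) (x : ι → M) : ∑ i ∈ T, x (τ i) = ∑ i ∈ T, x i :=
  Finset.sum_equiv τ (fun i => (perm_mem_iff_of_fixes hT i).symm) fun _ _ => rfl

end CycleCovers

/-! ### Tropical eigenvalues and cycle weights. -/

section TropicalEigenvalues

variable {d : ℕ} (A : Matrix (Fin d) (Fin d) (WithTop ℝ))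

/-- Expand each product in the permanent: `T` is the set of columns where the matrix entry is
chosen. The other columns contribute `X` if `τ` fixes them and kill the product otherwise. -/
lemma tropCharpoly_coeff (k : ℕ) :
    Tropical.untrop ((tropCharpoly A).coeff k) =
      (Finset.univ.filter fun x : Equiv.Perm (Fin d) × Finset (Fin d) =>
        (∀ i ∉ x.2, x.1 i = i) ∧ k = d - x.2.card).inf fun x => cycleWeight A x.1 x.2 := by
  classical
  have key : tropCharpoly A = ∑ x : Equiv.Perm (Fin d) × Finset (Fin d),
      if ∀ i ∉ x.2, x.1 i = i then
        Polynomial.C (Tropical.trop (cycleWeight A x.1 x.2)) * Polynomial.X ^ (d - x.2.card)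
      else 0 := by
    rw [tropCharpoly, Matrix.permanent, Fintype.sum_prod_type]
    refine Finset.sum_congr rfl fun τ _ => ?_
    simp only [Matrix.of_apply]
    rw [Finset.prod_add, Finset.powerset_univ]
    refine Finset.sum_congr rfl fun T _ => ?_
    rw [← map_prod, show Tropical.trop (cycleWeight A τ T) = ∏ i ∈ T, Tropical.trop (A (τ i) i) from
      trop_sum _ _]
    split_ifs with h
    · congr 1
      rw [Finset.prod_congr rfl (g := fun _ => Polynomial.X) fun i hi => ?_]
      · rw [Finset.prod_const, Finset.card_sdiff_of_subset (Finset.subset_univ _), Finset.card_univ,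
          Fintype.card_fin]
      · exact if_pos (h i (Finset.mem_sdiff.1 hi).2)
    · push Not at h
      obtain ⟨i, hi, hne⟩ := h
      rw [Finset.prod_eq_zero (i := i) (Finset.mem_sdiff.2 ⟨Finset.mem_univ _, hi⟩) (if_neg hne), mul_zero]
  rw [key, Polynomial.finsetSum_coeff, Finset.untrop_sum']
  refine eq_of_forall_le_iff fun z => ?_
  rw [Finset.le_inf_iff, Finset.le_inf_iff]
  have hx : ∀ x : Equiv.Perm (Fin d) × Finset (Fin d),
      Tropical.untrop ((if ∀ i ∉ x.2, x.1 i = i then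
        Polynomial.C (Tropical.trop (cycleWeight A x.1 x.2)) * Polynomial.X ^ (d - x.2.card)
      else 0).coeff k) =
      if (∀ i ∉ x.2, x.1 i = i) ∧ k = d - x.2.card then cycleWeight A x.1 x.2 else ⊤ := by
    intro x
    by_cases h1 : ∀ i ∉ x.2, x.1 i = i
    · by_cases h2 : k = d - x.2.card
      · rw [if_pos h1, if_pos ⟨h1, h2⟩, Polynomial.coeff_C_mul_X_pow, if_pos h2,
          Tropical.untrop_trop]
      · rw [if_pos h1, if_neg fun h => h2 h.2, Polynomial.coeff_C_mul_X_pow, if_neg h2,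
          Tropical.untrop_zero]
    · rw [if_neg h1, if_neg fun h => h1 h.1, Polynomial.coeff_zero, Tropical.untrop_zero]
  simp only [Function.comp_apply, hx, Finset.mem_univ, true_imp_iff, Finset.mem_filter, true_and]
  refine forall_congr' fun x => ?_
  split_ifs with h
  · exact ⟨fun h' _ => h', fun h' => h' h⟩
  · simp only [le_top, true_iff]
    exact fun h' => absurd h' h

lemma tropCharpoly_coeff_le {τ : Equiv.Perm (Fin d)} {T : Finset (Fin d)} (hT : ∀ i ∉ T, τ i = i) :
    Tropical.untrop ((tropCharpoly A).coeff (d - T.card)) ≤ cycleWeight A τ T := by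
  rw [tropCharpoly_coeff]
  exact Finset.inf_le (f := fun x : Equiv.Perm (Fin d) × Finset (Fin d) => cycleWeight A x.1 x.2)
    (b := (τ, T)) (Finset.mem_filter.2 ⟨Finset.mem_univ _, hT, rfl⟩)

lemma tropCharpoly_coeff_of_gt {k : ℕ} (hk : d < k) :
    Tropical.untrop ((tropCharpoly A).coeff k) = ⊤ := by
  rw [tropCharpoly_coeff, Finset.filter_eq_empty_iff.2, Finset.inf_empty]
  rintro x - ⟨-, h⟩
  omega

lemma tropCharpoly_coeff_self : Tropical.untrop ((tropCharpoly A).coeff d) = 0 := by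
  refine le_antisymm ?_ ?_
  · simpa [cycleWeight] using tropCharpoly_coeff_le A (τ := 1) (T := ∅) (fun _ _ => rfl)
  · rw [tropCharpoly_coeff, Finset.le_inf_iff]
    intro x hx
    obtain ⟨-, hx1, hx2⟩ := Finset.mem_filter.1 hx
    have h1 : x.2.card ≤ d := by simpa using Finset.card_le_univ x.2
    have h2 : x.2 = ∅ := by rw [← Finset.card_eq_zero]; omega
    simp [cycleWeight, h2]

lemma tropCharpoly_coeff_pos
    (h : ∀ (τ : Equiv.Perm (Fin d)) (T : Finset (Fin d)), (∀ i ∉ T, τ i = i) → T.Nonempty →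
      0 < cycleWeight A τ T) {k : ℕ} (hk : k < d) :
    0 < Tropical.untrop ((tropCharpoly A).coeff k) := by
  rw [tropCharpoly_coeff, Finset.lt_inf_iff (by simp)]
  intro x hx
  obtain ⟨-, hx1, hx2⟩ := Finset.mem_filter.1 hx
  refine h _ _ hx1 (Finset.card_pos.1 (by omega))

lemma tropCharpoly_eval (l : WithTop ℝ) :
    Tropical.untrop ((tropCharpoly A).eval (Tropical.trop l)) =
      (Finset.range (d + 1)).inf fun k => Tropical.untrop ((tropCharpoly A).coeff k) + k • l := by
  have hdeg : (tropCharpoly A).natDegree < d + 1 := by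
    refine Nat.lt_succ_of_le (Polynomial.natDegree_le_iff_coeff_eq_zero.2 fun k hk => ?_)
    exact Tropical.untrop_injective (tropCharpoly_coeff_of_gt A hk)
  rw [Polynomial.eval_eq_sum_range' hdeg, Finset.untrop_sum']
  refine Finset.inf_congr rfl fun k _ => ?_
  simp

/-- All tropical eigenvalues are positive if and only if all cycles have positive weight. -/
lemma tropEigenvalues_pos_iff :
    (∀ l, IsTropEigenvalue A l → 0 < l) ↔
      ∀ (τ : Equiv.Perm (Fin d)) (T : Finset (Fin d)), (∀ i ∉ T, τ i = i) → T.Nonempty →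
        0 < cycleWeight A τ T := by
  set c : ℕ → WithTop ℝ := fun k => Tropical.untrop ((tropCharpoly A).coeff k) with hc
  have hterm : ∀ (k : ℕ) (l : WithTop ℝ),
      (tropCharpoly A).coeff k * Tropical.trop l ^ k = (tropCharpoly A).eval (Tropical.trop l) ↔
        c k + k • l = (Finset.range (d + 1)).inf fun k => c k + k • l := by
    intro k l
    rw [← tropCharpoly_eval, ← Tropical.untrop_inj_iff]
    simp [hc]
  have hle : ∀ (l : WithTop ℝ) (k : ℕ), k ≤ d →
      ((Finset.range (d + 1)).inf fun k => c k + k • l) ≤ c k + k • l := fun l k hk =>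
    Finset.inf_le (Finset.mem_range.2 (Nat.lt_succ_of_le hk))
  have hcd : c d = 0 := tropCharpoly_coeff_self A
  constructor
  · intro h τ T hT hne
    by_contra hneg
    rw [not_lt] at hneg
    have hTd : T.card ≤ d := by simpa using Finset.card_le_univ T
    have hT0 : 0 < T.card := Finset.card_pos.2 hne
    have hcT : c (d - T.card) ≤ 0 := (tropCharpoly_coeff_le A hT).trans hneg
    let S : Finset ℕ := (Finset.Icc 1 d).filter fun k => c (d - k) ≠ ⊤
    have hS : S.Nonempty := ⟨T.card, by
      simp only [S, Finset.mem_filter, Finset.mem_Icc]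
      exact ⟨⟨hT0, hTd⟩, ne_top_of_le_ne_top WithTop.zero_ne_top hcT⟩⟩
    -- The minimal slope of the Newton polygon seen from its vertex `(d, 0)` is an eigenvalue,
    -- attained by the monomials `d` and `d - m`. The default of `untopD` is never used, since `S`
    -- only keeps finite coefficients.
    obtain ⟨m, hmS, hm⟩ := S.exists_min_image (fun k => (c (d - k)).untopD 0 / k) hS
    have hval : ∀ k ∈ S, ∃ r : ℝ, c (d - k) = r ∧ (c (d - k)).untopD 0 = r := by
      intro k hk
      obtain ⟨r, hr⟩ := WithTop.ne_top_iff_exists.1 (Finset.mem_filter.1 hk).2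
      exact ⟨r, hr.symm, by rw [← hr]; rfl⟩
    obtain ⟨r, hr, hr'⟩ := hval m hmS
    have hm1 : 1 ≤ m ∧ m ≤ d := Finset.mem_Icc.1 (Finset.mem_filter.1 hmS).1
    have hmpos : (0 : ℝ) < m := by exact_mod_cast hm1.1
    have hsm : ∀ k : ℕ, k • ((r / m : ℝ) : WithTop ℝ) = ((k * (r / m) : ℝ) : WithTop ℝ) := by
      intro k; rw [← WithTop.coe_nsmul, nsmul_eq_mul]
    have hinf : ((Finset.range (d + 1)).inf fun k => c k + k • ((r / m : ℝ) : WithTop ℝ)) =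
        c d + d • ((r / m : ℝ) : WithTop ℝ) := by
      refine le_antisymm (hle _ d le_rfl) (Finset.le_inf fun k hk => ?_)
      have hkd : k ≤ d := Nat.lt_succ_iff.1 (Finset.mem_range.1 hk)
      rcases hkd.eq_or_lt with rfl | hkd
      · exact le_rfl
      by_cases htop : c k = ⊤
      · rw [htop, WithTop.top_add]; exact le_top
      have hkS : d - k ∈ S := by
        simp only [S, Finset.mem_filter, Finset.mem_Icc]
        refine ⟨⟨by omega, by omega⟩, ?_⟩
        rwa [Nat.sub_sub_self hkd.le]
      obtain ⟨s, hs, hs'⟩ := hval _ hkS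
      have h1 := hm _ hkS
      rw [hr', hs', Nat.cast_sub hkd.le] at h1
      rw [Nat.sub_sub_self hkd.le] at hs
      have hpos : (0 : ℝ) < (d : ℝ) - k := by
        have : (k : ℝ) < d := by exact_mod_cast hkd
        linarith
      rw [le_div_iff₀ hpos] at h1
      rw [hcd, hs, hsm, hsm, zero_add, ← WithTop.coe_add]
      have : (d : ℝ) * (r / m) ≤ s + k * (r / m) := by linarith
      exact_mod_cast this
    have hpos := h ((r / m : ℝ) : WithTop ℝ) ⟨d, d - m, (Nat.sub_lt (hm1.1.trans hm1.2) hm1.1).ne', (hterm _ _).2 hinf.symm, (hterm _ _).2 (by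
      rw [hinf, hcd, hr, hsm, hsm, zero_add, ← WithTop.coe_add, Nat.cast_sub hm1.2]
      congr 1
      field_simp
      ring)⟩
    have hTS : T.card ∈ S := by
      simp only [S, Finset.mem_filter, Finset.mem_Icc]
      exact ⟨⟨hT0, hTd⟩, ne_top_of_le_ne_top WithTop.zero_ne_top hcT⟩
    obtain ⟨s, hs, hs'⟩ := hval _ hTS
    have h1 := hm _ hTS
    rw [hr', hs'] at h1
    rw [hs] at hcT
    have hs0 : s ≤ 0 := by exact_mod_cast hcT
    have : r / m ≤ 0 := h1.trans (div_nonpos_of_nonpos_of_nonneg hs0 (Nat.cast_nonneg _))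
    have h2 : 0 < r / m := by exact_mod_cast hpos
    linarith
  · rintro h l ⟨k, m, hkm, hk, hm⟩
    rw [hterm] at hk hm
    by_contra hl
    rw [not_lt] at hl
    have hlt : l ≠ ⊤ := ne_top_of_le_ne_top WithTop.zero_ne_top hl
    lift l to ℝ using hlt
    have hl0 : l ≤ 0 := by exact_mod_cast hl
    have hsm : ∀ k : ℕ, k • (l : WithTop ℝ) = ((k * l : ℝ) : WithTop ℝ) := by
      intro k; rw [← WithTop.coe_nsmul, nsmul_eq_mul]
    -- For `l ≤ 0` the leading monomial is strictly smaller than all others, since lower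
    -- coefficients are positive and `d • l ≤ k • l`.
    have key : ∀ k, c k + k • (l : WithTop ℝ) =
        ((Finset.range (d + 1)).inf fun k => c k + k • (l : WithTop ℝ)) → k = d := by
      intro k hk
      have h1 := hk.trans_le (hle l d le_rfl)
      rw [hcd, zero_add, hsm, hsm] at h1
      rcases lt_trichotomy k d with hlt | heq | hgt
      · have h2 := tropCharpoly_coeff_pos A h hlt
        change 0 < c k at h2
        have h3 : c k ≠ ⊤ := fun h3 => by
          rw [h3, WithTop.top_add, top_le_iff] at h1
          exact WithTop.coe_ne_top h1
        obtain ⟨s, hs⟩ := WithTop.ne_top_iff_exists.1 h3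
        rw [← hs] at h1 h2
        have h4 : s + k * l ≤ d * l := by exact_mod_cast h1
        have h5 : 0 < s := by exact_mod_cast h2
        have h6 : (k : ℝ) ≤ d := by exact_mod_cast hlt.le
        nlinarith
      · exact heq
      · rw [show c k = ⊤ from tropCharpoly_coeff_of_gt A hgt, WithTop.top_add, top_le_iff] at h1
        exact absurd h1 WithTop.coe_ne_top
    exact hkm ((key k hk).trans (key m hm).symm)

end TropicalEigenvalues

/-! ### Contraction of tropical germs. -/

section TropicalGerms

variable {d : ℕ}

/-- The coefficients of a convergent tropical germ are bounded below by an affine function of the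
degree. -/
lemma IsConvergentTropGerm.coeff_ge {f : Fin d → TropSeries d} (hf : IsConvergentTropGerm f) :
    ∃ a b : ℝ, 0 ≤ a ∧ ∀ i I, ((b - a * I.degree : ℝ) : WithTop ℝ) ≤ f i I := by
  have h1 : ∀ i, ∃ a b : ℝ, ∀ I, ((b - a * I.degree : ℝ) : WithTop ℝ) ≤ f i I := by
    intro i
    obtain ⟨U, hU, S, hS⟩ := (hf i).1
    obtain ⟨t, ht⟩ := WithTop.nhds_pi_top_basis hU
    obtain ⟨b, hb⟩ := WithTop.exists_real_lt (S.inf ((f i).term fun _ => (t : WithTop ℝ)))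
    refine ⟨t, b, fun I => ?_⟩
    have h2 := hb.le.trans (hS (fun _ => (t : WithTop ℝ)) (ht _ fun _ => le_rfl) I)
    have h3 : (f i).term (fun _ => (t : WithTop ℝ)) I = f i I + ((t * I.degree : ℝ) : WithTop ℝ) := by
      rw [TropSeries.term, Finsupp.degree_eq_sum, Nat.cast_sum, Finset.mul_sum, WithTop.coe_sum]
      refine congrArg _ (Finset.sum_congr rfl fun j _ => ?_)
      rw [← WithTop.coe_nsmul, nsmul_eq_mul, mul_comm]
    rw [h3] at h2
    rw [show b - t * I.degree = b + -(t * I.degree) from sub_eq_add_neg _ _, WithTop.coe_add]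
    refine (add_le_add_left h2 _).trans_eq ?_
    rw [add_assoc, ← WithTop.coe_add]
    simp
  choose a b hab using h1
  refine ⟨∑ i, |a i|, -∑ i, |b i|, Finset.sum_nonneg fun _ _ => abs_nonneg _, fun i I => le_trans ?_ (hab i I)⟩
  have ha : a i ≤ ∑ i, |a i| := (le_abs_self _).trans
    (Finset.single_le_sum (f := fun i => |a i|) (fun i _ => abs_nonneg _) (Finset.mem_univ i))
  have hb : -b i ≤ ∑ i, |b i| := (neg_le_abs _).trans
    (Finset.single_le_sum (f := fun i => |b i|) (fun i _ => abs_nonneg _) (Finset.mem_univ i))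
  have := mul_le_mul_of_nonneg_right ha (Nat.cast_nonneg (α := ℝ) I.degree)
  have h5 : -∑ i, |b i| - (∑ i, |a i|) * I.degree ≤ b i - a i * I.degree := by linarith
  exact_mod_cast h5

lemma coe_sum_nsmul_le {x : Fin d → WithTop ℝ} {m : Fin d → ℝ} (hx : ∀ i, (m i : WithTop ℝ) ≤ x i)
    (I : Fin d →₀ ℕ) : ((∑ i, I i * m i : ℝ) : WithTop ℝ) ≤ ∑ i, I i • x i := by
  rw [WithTop.coe_sum]
  refine Finset.sum_le_sum fun i _ => ?_
  rw [← nsmul_eq_mul, WithTop.coe_nsmul]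
  exact nsmul_le_nsmul_right (hx i) _

lemma TropSeries.term_single (φ : TropSeries d) (x : Fin d → WithTop ℝ) (j : Fin d) :
    φ.term x (Finsupp.single j 1) = φ (Finsupp.single j 1) + x j := by
  rw [TropSeries.term, Finset.sum_eq_single j]
  · simp
  · intro i _ hij
    simp [hij.symm]
  · simp

lemma exists_eq_single_of_degree_eq_one {I : Fin d →₀ ℕ} (hI : I.degree = 1) :
    ∃ j, I = Finsupp.single j 1 := by
  obtain ⟨j, hj⟩ : ∃ j, I j ≠ 0 := by
    by_contra! h
    rw [show I = 0 from Finsupp.ext h] at hI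
    simp at hI
  have h1 : Finsupp.single j 1 ≤ I := by
    rw [Finsupp.single_le_iff]
    omega
  have h2 := congrArg Finsupp.degree (add_tsub_cancel_of_le h1)
  rw [map_add, Finsupp.degree_single, hI] at h2
  have h3 : I - Finsupp.single j 1 = 0 := by
    rw [← Finsupp.degree_eq_zero_iff]
    omega
  exact ⟨j, le_antisymm (tsub_eq_zero_iff_le.1 h3) h1⟩

/-- Near `∞`, a germ whose linear part increases a weighted order by `ε` increases the weighted
order by `ε`. -/
lemma term_ge_of_potential {f : Fin d → TropSeries d} (hf : IsConvergentTropGerm f)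
    {p : Fin d → ℝ} {ε : ℝ}
    (hp : ∀ i j, ((p i + ε : ℝ) : WithTop ℝ) ≤ tropLinearPart f i j + p j) :
    ∃ t₀ : ℝ, ∀ r ≥ t₀, ∀ x : Fin d → WithTop ℝ, (∀ i, ((p i + r : ℝ) : WithTop ℝ) ≤ x i) →
      ∀ i I, ((p i + r + ε : ℝ) : WithTop ℝ) ≤ (f i).term x I := by
  obtain ⟨a, b, ha, hab⟩ := hf.coeff_ge
  set P : ℝ := ∑ i, |p i| with hP
  have hP0 : 0 ≤ P := Finset.sum_nonneg fun _ _ => abs_nonneg _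
  have hpP : ∀ i, |p i| ≤ P := fun i =>
    Finset.single_le_sum (f := fun i => |p i|) (fun i _ => abs_nonneg _) (Finset.mem_univ i)
  -- The first summand makes `r - a - P` nonnegative, so degree two is the worst among higher
  -- degrees. The second ensures `b + 2 * (r - a - P) ≥ P + r + ε`.
  refine ⟨|a + P| + |P + ε - b + 2 * a + 2 * P|, fun r hr x hx i I => ?_⟩
  have hr1 : a + P ≤ r := by
    have := le_abs_self (a + P); have := abs_nonneg (P + ε - b + 2 * a + 2 * P); linarith
  have hr2 : P + ε - b + 2 * a + 2 * P ≤ r := by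
    have := le_abs_self (P + ε - b + 2 * a + 2 * P); have := abs_nonneg (a + P); linarith
  have hsum := coe_sum_nsmul_le hx I
  rcases Nat.lt_or_ge I.degree 2 with hI | hI
  · interval_cases hdeg : I.degree
    · rw [Finsupp.degree_eq_zero_iff] at hdeg
      rw [hdeg, TropSeries.term, (hf i).2, WithTop.top_add]
      exact le_top
    · obtain ⟨j, rfl⟩ : ∃ j, I = Finsupp.single j 1 := exists_eq_single_of_degree_eq_one hdeg
      rw [TropSeries.term_single]
      calc ((p i + r + ε : ℝ) : WithTop ℝ) = ((p i + ε : ℝ) : WithTop ℝ) + (r : WithTop ℝ) := by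
            norm_cast; ring
        _ ≤ tropLinearPart f i j + p j + r := by gcongr; exact hp i j
        _ = f i (Finsupp.single j 1) + ((p j + r : ℝ) : WithTop ℝ) := by
            rw [WithTop.coe_add, add_assoc]; rfl
        _ ≤ _ := by gcongr; exact hx j
  · have h1 : ((b - a * I.degree + ∑ i, I i * (p i + r) : ℝ) : WithTop ℝ) ≤ (f i).term x I := by
      rw [WithTop.coe_add]
      exact add_le_add (hab i I) hsum
    refine le_trans ?_ h1
    have h2 : (I.degree : ℝ) * (r - P) ≤ ∑ i, I i * (p i + r) := by
      rw [Finsupp.degree_eq_sum, Nat.cast_sum, Finset.sum_mul]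
      refine Finset.sum_le_sum fun j _ => mul_le_mul_of_nonneg_left ?_ (Nat.cast_nonneg _)
      have := neg_abs_le (p j); have := hpP j
      linarith
    have h3 : (2 : ℝ) ≤ I.degree := by exact_mod_cast hI
    have h4 : 2 * (r - a - P) ≤ I.degree * (r - a - P) :=
      mul_le_mul_of_nonneg_right h3 (by linarith)
    have h5 : p i ≤ P := (le_abs_self _).trans (hpP i)
    have : p i + r + ε ≤ b - a * I.degree + ∑ i, I i * (p i + r) := by nlinarith
    exact_mod_cast this

lemma isContractingTropGerm_of_potential {f : Fin d → TropSeries d} (hf : IsConvergentTropGerm f)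
    {p : Fin d → ℝ} {ε : ℝ} (hε : 0 < ε)
    (hp : ∀ i j, ((p i + ε : ℝ) : WithTop ℝ) ≤ tropLinearPart f i j + p j) :
    IsContractingTropGerm f := by
  obtain ⟨t₀, ht₀⟩ := term_ge_of_potential hf hp
  intro U hU
  have hconv : ∀ i, ∃ W ∈ 𝓝 (fun _ : Fin d => (⊤ : WithTop ℝ)), ∀ x ∈ W, ∃ y,
      IsGLB (Set.range ((f i).term x)) y := by
    intro i
    obtain ⟨W, hW, S, hS⟩ := (hf i).1
    refine ⟨W, hW, fun x hx => ⟨S.inf ((f i).term x), ?_, fun z hz => ?_⟩⟩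
    · rintro _ ⟨I, rfl⟩
      exact hS x hx I
    · exact Finset.le_inf fun I _ => hz ⟨I, rfl⟩
  choose W hW hWy using hconv
  obtain ⟨t₁, ht₁⟩ := WithTop.nhds_pi_top_basis (inter_mem hU (iInter_mem.2 hW))
  set r : ℝ := max t₀ (t₁ + ∑ i, |p i|) with hr
  have hpr : ∀ i, t₁ ≤ p i + r := fun i => by
    have h1 := neg_abs_le (p i)
    have h2 : |p i| ≤ ∑ i, |p i| :=
      Finset.single_le_sum (f := fun i => |p i|) (fun i _ => abs_nonneg _) (Finset.mem_univ i)
    have h3 := le_max_right t₀ (t₁ + ∑ i, |p i|)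
    rw [← hr] at h3
    linarith
  let V : Set (Fin d → WithTop ℝ) := {x | ∀ i, ((p i + r : ℝ) : WithTop ℝ) < x i}
  let C : Set (Fin d → WithTop ℝ) := Set.univ.pi fun i => Set.Ici ((p i + r + ε : ℝ) : WithTop ℝ)
  have hV : ∀ x ∈ V, x ∈ U ∩ ⋂ i, W i := fun x hx =>
    ht₁ x fun i => le_trans (by exact_mod_cast hpr i) (hx i).le
  have hC : IsCompact C := isCompact_univ_pi fun i => WithTop.isCompact_Ici_coe _
  have hcl : closure {y | ∃ x ∈ V, TropMapsTo f x y} ⊆ C := by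
    refine closure_minimal ?_ (isClosed_set_pi fun i _ => isClosed_Ici)
    rintro y ⟨x, hx, hxy⟩ i -
    refine (le_isGLB_iff (hxy i)).2 ?_
    rintro _ ⟨I, rfl⟩
    exact ht₀ r (le_max_left _ _) x (fun i => (hx i).le) i I
  refine ⟨V, fun x hx => (hV x hx).1, WithTop.isOpen_box _, fun i => WithTop.coe_lt_top _,
    fun x hx => ?_, hC.of_isClosed_subset isClosed_closure hcl, hcl.trans fun y hy i => ?_⟩
  · choose y hy using fun i => hWy i x (Set.mem_iInter.1 (hV x hx).2 i)
    exact ⟨y, hy⟩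
  · refine lt_of_lt_of_le ?_ (hy i (Set.mem_univ i))
    have : p i + r < p i + r + ε := by linarith
    exact_mod_cast this

lemma exists_mem_forall_lt {ι : Type*} [Finite ι] {V : Set (ι → WithTop ℝ)} (hV : IsOpen V)
    {c : ι → WithTop ℝ} (hc : c ∈ V) : ∃ x ∈ V, ∀ i, x i < c i := by
  have h : ∀ i, (𝓝[<] (c i)).NeBot := fun i => by
    obtain ⟨m, hm⟩ := WithTop.exists_real_lt (c i)
    exact nhdsWithin_Iio_neBot' ⟨_, hm⟩ le_rfl
  have h1 : Tendsto (fun x : ι → WithTop ℝ => x) (Filter.pi fun i => 𝓝[<] (c i)) (𝓝 c) := by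
    rw [nhds_pi]
    exact Filter.pi_mono fun i => nhdsWithin_le_nhds
  have h2 : ∀ᶠ x in Filter.pi fun i => 𝓝[<] (c i), ∀ i, x i < c i :=
    eventually_all.2 fun i => (tendsto_eval_pi _ i).eventually self_mem_nhdsWithin
  obtain ⟨x, hx1, hx2⟩ := ((h1.eventually (hV.mem_nhds hc)).and h2).exists
  exact ⟨x, hx1, hx2⟩

/-- If the weight is nonpositive, the linear terms along the cycles show that `∑_{i ∈ T} x_i` does
not increase under `f`. Take a point of the compact closure of the image where this sum is minimal.
It lies in the open set `V`, so it can be lowered in all coordinates within `V`, and the image of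
the lowered point beats the minimum. -/
lemma cycleWeight_pos_of_isContractingTropGerm {f : Fin d → TropSeries d}
    (hf : IsContractingTropGerm f) {τ : Equiv.Perm (Fin d)} {T : Finset (Fin d)}
    (hT : ∀ i ∉ T, τ i = i) (hne : T.Nonempty) : 0 < cycleWeight (tropLinearPart f) τ T := by
  by_contra hneg
  rw [not_lt] at hneg
  obtain ⟨V, -, hVo, hV0, hVd, hC, hCV⟩ := hf Set.univ univ_mem
  set C := closure {y | ∃ x ∈ V, TropMapsTo f x y}
  have hCne : C.Nonempty := by
    obtain ⟨y, hy⟩ := hVd _ hV0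
    exact ⟨y, subset_closure ⟨_, hV0, hy⟩⟩
  obtain ⟨c, hcC, hc⟩ := hC.exists_isMinOn hCne
    (f := fun x : Fin d → WithTop ℝ => ∑ i ∈ T, x i)
    (continuous_finsetSum T fun i _ => continuous_apply i).continuousOn
  obtain ⟨x, hxV, hxc⟩ := exists_mem_forall_lt hVo (hCV hcC)
  obtain ⟨y, hy⟩ := hVd x hxV
  have h1 : ∑ i ∈ T, c i ≤ ∑ i ∈ T, y i := hc (subset_closure ⟨x, hxV, hy⟩)
  have h2 : ∑ i ∈ T, y i ≤ ∑ i ∈ T, x i := by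
    rw [← sum_perm_of_fixes hT y]
    calc ∑ i ∈ T, y (τ i) ≤ ∑ i ∈ T, (tropLinearPart f (τ i) i + x i) := by
          refine Finset.sum_le_sum fun i _ => ?_
          refine ((hy (τ i)).1 ⟨Finsupp.single i 1, rfl⟩).trans_eq ?_
          rw [TropSeries.term_single]; rfl
      _ = cycleWeight (tropLinearPart f) τ T + ∑ i ∈ T, x i := Finset.sum_add_distrib
      _ ≤ 0 + ∑ i ∈ T, x i := by gcongr
      _ = _ := zero_add _
  have h3 : ∑ i ∈ T, x i < ∑ i ∈ T, c i := by
    have hx : ∀ i, ∃ s : ℝ, (s : WithTop ℝ) = x i := fun i =>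
      WithTop.ne_top_iff_exists.1 (hxc i).ne_top
    choose s hs using hx
    by_cases htop : ∑ i ∈ T, c i = ⊤
    · rw [htop]
      simp only [← hs, ← WithTop.coe_sum]
      exact WithTop.coe_lt_top _
    · have hct : ∀ i ∈ T, c i ≠ ⊤ := fun i hi h => htop (WithTop.sum_eq_top.2 ⟨i, hi, h⟩)
      have : ∀ i ∈ T, c i = ((c i).untopD 0 : ℝ) := fun i hi => by
        obtain ⟨u, hu⟩ := WithTop.ne_top_iff_exists.1 (hct i hi)
        rw [← hu]; rfl
      rw [Finset.sum_congr rfl this]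
      simp only [← hs, ← WithTop.coe_sum]
      rw [WithTop.coe_lt_coe]
      refine Finset.sum_lt_sum_of_nonempty hne fun i hi => ?_
      have h4 := hxc i
      rw [this i hi, ← hs] at h4
      exact_mod_cast h4
  exact absurd (h1.trans h2) (not_le.2 h3)

end TropicalGerms

/-! ### Valuations along Cauchy families. -/

section LimitsOfValuations

variable {R : Type*} [CommRing R] {α : Type*} {l : Filter α}

lemma tendsto_val_of_tendsto_val_sub {w : α → AddValuation R (WithTop ℝ)} {u u' : α → R}
    {v : WithTop ℝ} (hu : Tendsto (fun s => w s (u s)) l (𝓝 v))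
    (hsub : Tendsto (fun s => w s (u s - u' s)) l (𝓝 ⊤)) :
    Tendsto (fun s => w s (u' s)) l (𝓝 v) := by
  induction v with
  | top =>
    rw [WithTop.tendsto_nhds_top_real] at hu hsub ⊢
    intro m
    filter_upwards [hu m, hsub m] with s h1 h2
    have := (w s).map_le_sub h1 h2
    rwa [sub_sub_cancel] at this
  | coe v =>
    have h1 : ∀ᶠ s in l, w s (u s) < ((v + 1 : ℝ) : WithTop ℝ) :=
      hu.eventually (gt_mem_nhds (by exact_mod_cast lt_add_one v))
    have h2 := WithTop.tendsto_nhds_top_real.1 hsub (v + 1)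
    refine hu.congr' ?_
    filter_upwards [h1, h2] with s hs1 hs2
    rw [(w s).map_sub_swap] at hs2
    exact ((w s).map_eq_of_lt_sub (hs1.trans_le hs2)).symm

/-- By the ultrametric inequality, the valuation of a Cauchy family is eventually constant unless it
tends to `∞`. -/
lemma exists_tendsto_val (w : AddValuation R (WithTop ℝ)) {u : α → R}
    (h : ∀ M : ℝ, ∃ s₀, (∀ᶠ s in l, (M : WithTop ℝ) ≤ w (u s - u s₀))) :
    ∃ v, Tendsto (fun s => w (u s)) l (𝓝 v) := by
  by_cases hc : ∃ (M : ℝ) (s₀ : α), (∀ᶠ s in l, (M : WithTop ℝ) ≤ w (u s - u s₀)) ∧ w (u s₀) < M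
  · obtain ⟨M, s₀, h1, h2⟩ := hc
    refine ⟨w (u s₀), tendsto_const_nhds.congr' ?_⟩
    filter_upwards [h1] with s hs
    exact (w.map_eq_of_lt_sub (h2.trans_le hs)).symm
  · push Not at hc
    refine ⟨⊤, WithTop.tendsto_nhds_top_real.2 fun M => ?_⟩
    obtain ⟨s₀, hs₀⟩ := h M
    filter_upwards [hs₀] with s hs
    have := w.map_le_add hs (hc M s₀ hs₀)
    rwa [sub_add_cancel] at this

end LimitsOfValuations

/-! ### Power series with coefficients of bounded growth. -/

section DegreeBounds

variable {K : Type*} [Field K] (ν : AddValuation K (WithTop ℝ)) {d : ℕ}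

/-- The coefficients of `g` have valuations at least `b - a |I|` for some `b`. -/
def IsDegreeBounded (a : ℝ) (g : MvPowerSeries (Fin d) K) : Prop :=
  ∃ b : ℝ, ∀ I, ((b - a * I.degree : ℝ) : WithTop ℝ) ≤ ν (MvPowerSeries.coeff I g)

variable {ν} {a : ℝ}

lemma le_val_coeff_mul {g h : MvPowerSeries (Fin d) K} {b c : ℝ}
    (hg : ∀ I, ((b - a * I.degree : ℝ) : WithTop ℝ) ≤ ν (MvPowerSeries.coeff I g))
    (hh : ∀ I, ((c - a * I.degree : ℝ) : WithTop ℝ) ≤ ν (MvPowerSeries.coeff I h))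
    (I : Fin d →₀ ℕ) :
    ((b + c - a * I.degree : ℝ) : WithTop ℝ) ≤ ν (MvPowerSeries.coeff I (g * h)) := by
  classical
  rw [MvPowerSeries.coeff_mul]
  refine ν.map_le_sum fun x hx => ?_
  rw [ν.map_mul, ← Finset.HasAntidiagonal.mem_antidiagonal.1 hx, map_add, Nat.cast_add]
  refine le_trans (le_of_eq ?_) (add_le_add (hg x.1) (hh x.2))
  rw [← WithTop.coe_add]
  congr 1
  ring

lemma IsDegreeBounded.mul {g h : MvPowerSeries (Fin d) K} (hg : IsDegreeBounded ν a g)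
    (hh : IsDegreeBounded ν a h) : IsDegreeBounded ν a (g * h) := by
  obtain ⟨b, hb⟩ := hg
  obtain ⟨c, hc⟩ := hh
  exact ⟨b + c, le_val_coeff_mul hb hc⟩

lemma IsDegreeBounded.add {g h : MvPowerSeries (Fin d) K} (hg : IsDegreeBounded ν a g)
    (hh : IsDegreeBounded ν a h) : IsDegreeBounded ν a (g + h) := by
  obtain ⟨b, hb⟩ := hg
  obtain ⟨c, hc⟩ := hh
  refine ⟨min b c, fun I => ?_⟩
  rw [map_add]
  refine ν.map_le_add (le_trans ?_ (hb I)) (le_trans ?_ (hc I))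
  · have := min_le_left b c
    exact_mod_cast (by linarith : min b c - a * I.degree ≤ b - a * I.degree)
  · have := min_le_right b c
    exact_mod_cast (by linarith : min b c - a * I.degree ≤ c - a * I.degree)

lemma exists_le_val_coeff (P : MvPolynomial (Fin d) K) :
    ∃ b : ℝ, ∀ I, (b : WithTop ℝ) ≤ ν (P.coeff I) := by
  obtain ⟨b, hb⟩ := WithTop.exists_real_lt (P.support.inf fun I => ν (P.coeff I))
  refine ⟨b, fun I => ?_⟩
  by_cases hI : I ∈ P.support
  · exact hb.le.trans (Finset.inf_le hI)
  · rw [MvPolynomial.notMem_support_iff.1 hI, ν.map_zero]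
    exact le_top

lemma isDegreeBounded_C (c : K) : IsDegreeBounded ν a (MvPowerSeries.C (σ := Fin d) c) := by
  classical
  obtain ⟨b, hb⟩ := WithTop.exists_real_lt (ν c)
  refine ⟨b, fun I => ?_⟩
  rw [MvPowerSeries.coeff_C]
  split_ifs with h
  · simpa [h] using hb.le
  · rw [ν.map_zero]; exact le_top

lemma isDegreeBounded_aeval {F : Fin d → MvPowerSeries (Fin d) K}
    (hF : ∀ i, IsDegreeBounded ν a (F i)) (P : MvPolynomial (Fin d) K) :
    IsDegreeBounded ν a (MvPolynomial.aeval F P) := by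
  induction P using MvPolynomial.induction_on with
  | C c =>
    rw [MvPolynomial.aeval_C]
    exact isDegreeBounded_C c
  | add p q hp hq => rw [map_add]; exact hp.add hq
  | mul_X p i hp => rw [map_mul, MvPolynomial.aeval_X]; exact hp.mul (hF i)

/-- The truncation of a power series to the exponents in a finite set. -/
noncomputable def seriesTrunc (g : MvPowerSeries (Fin d) K) (S : Finset (Fin d →₀ ℕ)) :
    MvPolynomial (Fin d) K :=
  ∑ I ∈ S, MvPolynomial.monomial I (MvPowerSeries.coeff I g)

open Classical in
lemma coeff_seriesTrunc (g : MvPowerSeries (Fin d) K) (S : Finset (Fin d →₀ ℕ)) (J : Fin d →₀ ℕ) :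
    (seriesTrunc g S).coeff J = if J ∈ S then MvPowerSeries.coeff J g else 0 := by
  rw [seriesTrunc, MvPolynomial.coeff_sum]
  simp [MvPolynomial.coeff_monomial]

lemma le_val_coeff_seriesTrunc {g : MvPowerSeries (Fin d) K} {b : ℝ}
    (hg : ∀ I, ((b - a * I.degree : ℝ) : WithTop ℝ) ≤ ν (MvPowerSeries.coeff I g))
    (S : Finset (Fin d →₀ ℕ)) (I : Fin d →₀ ℕ) :
    ((b - a * I.degree : ℝ) : WithTop ℝ) ≤ ν ((seriesTrunc g S).coeff I) := by
  classical
  rw [coeff_seriesTrunc]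
  split_ifs
  · exact hg I
  · rw [ν.map_zero]; exact le_top

lemma eventually_forall_degree_mem (d n : ℕ) :
    ∀ᶠ S : Finset (Fin d →₀ ℕ) in atTop, ∀ I : Fin d →₀ ℕ, I.degree < n → I ∈ S := by
  have hfin := Finsupp.finite_of_degree_lt (σ := Fin d) n
  filter_upwards [eventually_ge_atTop hfin.toFinset] with S hS I hI
  exact hS (hfin.mem_toFinset.2 hI)

end DegreeBounds

/-! ### Polydiscs in the Berkovich affine space. -/

namespace BerkovichAffine

variable {K : Type*} [Field K] {ν : AddValuation K (WithTop ℝ)} {d : ℕ}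

lemma val_monomial (w : BerkovichAffine ν d) (I : Fin d →₀ ℕ) (c : K) :
    w.val (MvPolynomial.monomial I c) = ν c + ∑ i, I i • w.val (MvPolynomial.X i) := by
  rw [MvPolynomial.monomial_eq, w.val.map_mul, w.val_C, Finsupp.prod_fintype _ _ (by simp)]
  congr 1
  have h : ∀ s : Finset (Fin d), w.val (∏ i ∈ s, MvPolynomial.X i ^ I i) =
      ∑ i ∈ s, I i • w.val (MvPolynomial.X i) := by
    intro s
    classical
    induction s using Finset.induction_on with
    | empty => simp
    | insert i s hi ih =>
      rw [Finset.prod_insert hi, Finset.sum_insert hi, w.val.map_mul, w.val.map_pow, ih]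
  exact h _

lemma le_val (w : BerkovichAffine ν d) {P : MvPolynomial (Fin d) K} {m : WithTop ℝ}
    (h : ∀ I, m ≤ ν (P.coeff I) + ∑ i, I i • w.val (MvPolynomial.X i)) : m ≤ w.val P := by
  conv_rhs => rw [P.as_sum]
  refine w.val.map_le_sum fun I _ => ?_
  rw [val_monomial]
  exact h I

/-- Seminorms of a polynomial without terms of low degree are small near the origin. -/
lemma le_val_of_degree (w : BerkovichAffine ν d) {a s b : ℝ} {n : ℕ} (has : a ≤ s)
    (hw : ∀ i, (s : WithTop ℝ) ≤ w.val (MvPolynomial.X i)) {P : MvPolynomial (Fin d) K}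
    (hP : ∀ I, ((b - a * I.degree : ℝ) : WithTop ℝ) ≤ ν (P.coeff I))
    (hn : ∀ I : Fin d →₀ ℕ, I.degree < n → P.coeff I = 0) :
    ((b + n * (s - a) : ℝ) : WithTop ℝ) ≤ w.val P := by
  refine w.le_val fun I => ?_
  rcases lt_or_ge I.degree n with hI | hI
  · rw [hn I hI, ν.map_zero, WithTop.top_add]; exact le_top
  · refine le_trans ?_ (add_le_add (hP I) (coe_sum_nsmul_le (m := fun _ => s) hw I))
    rw [← WithTop.coe_add, ← Finset.sum_mul, ← Nat.cast_sum, ← Finsupp.degree_eq_sum]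
    have h1 : (n : ℝ) ≤ I.degree := by exact_mod_cast hI
    have h2 := mul_le_mul_of_nonneg_right h1 (sub_nonneg.2 has)
    exact_mod_cast (by linarith : b + n * (s - a) ≤ b - a * I.degree + I.degree * s)

lemma continuous_val (P : MvPolynomial (Fin d) K) :
    Continuous fun w : BerkovichAffine ν d => w.val P :=
  (continuous_apply P).comp continuous_induced_dom

lemma tendsto_nhds_iff {α : Type*} {l : Filter α} {u : α → BerkovichAffine ν d}
    {w : BerkovichAffine ν d} :
    Tendsto u l (𝓝 w) ↔ ∀ P, Tendsto (fun s => (u s).val P) l (𝓝 (w.val P)) := by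
  rw [nhds_induced, tendsto_comap_iff, tendsto_pi_nhds]
  rfl

/-- A neighbourhood of the origin contains a polydisc. -/
lemma exists_polydisc_subset {U : Set (BerkovichAffine ν d)} (hU : U ∈ 𝓝 (origin ν d)) :
    ∃ t : ℝ, ∀ w : BerkovichAffine ν d, (∀ i, (t : WithTop ℝ) ≤ w.val (MvPolynomial.X i)) → w ∈ U := by
  let T : BerkovichAffine ν d → Fin d → WithTop ℝ := fun w i => w.val (MvPolynomial.X i)
  -- Where all coordinates are small, every polynomial is close to its constant term. So the
  -- coordinates alone control the neighbourhoods of the origin.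
  have h : Tendsto id (comap T (𝓝 fun _ => ⊤)) (𝓝 (origin ν d)) := by
    rw [tendsto_nhds_iff]
    intro P
    refine tendsto_val_of_tendsto_val_sub (w := fun w : BerkovichAffine ν d => w.val)
      (u := fun _ => MvPolynomial.C (MvPolynomial.constantCoeff P)) (u' := fun _ => P) ?_ ?_
    · simp only [val_C]
      exact tendsto_const_nhds
    · rw [WithTop.tendsto_nhds_top_real]
      intro M
      obtain ⟨b, hb⟩ := exists_le_val_coeff (ν := ν) (MvPolynomial.C (MvPolynomial.constantCoeff P) - P)
      have h1 : {x : Fin d → WithTop ℝ | ∀ i, ((max 0 (M - b) : ℝ) : WithTop ℝ) < x i} ∈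
          𝓝 fun _ : Fin d => (⊤ : WithTop ℝ) :=
        (WithTop.isOpen_box _).mem_nhds fun i => WithTop.coe_lt_top _
      filter_upwards [preimage_mem_comap h1] with w hw
      refine le_trans ?_ (w.le_val_of_degree (a := 0) (n := 1) (b := b) (le_max_left 0 (M - b))
        (fun i => (hw i).le) (fun I => by simpa using hb I) fun I hI => ?_)
      · have := le_max_right 0 (M - b)
        exact_mod_cast (by push_cast; linarith : M ≤ b + (1 : ℕ) * (max 0 (M - b) - 0))
      · have : I = 0 := by rw [← Finsupp.degree_eq_zero_iff]; omega
        rw [this, MvPolynomial.coeff_sub, MvPolynomial.coeff_zero_C]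
        exact sub_self _
  have hU' : U ∈ comap T (𝓝 fun _ => ⊤) := h hU
  obtain ⟨W, hW, hWU⟩ := hU'
  obtain ⟨t, ht⟩ := WithTop.nhds_pi_top_basis hW
  exact ⟨t, fun w hw => hWU (ht _ hw)⟩

lemma isOpen_polydisc (t : Fin d → ℝ) :
    IsOpen {w : BerkovichAffine ν d | ∀ i, (t i : WithTop ℝ) < w.val (MvPolynomial.X i)} :=
  (WithTop.isOpen_box t).preimage (continuous_pi fun i => continuous_val (MvPolynomial.X i))

lemma origin_mem_polydisc (t : Fin d → ℝ) :
    origin ν d ∈ {w : BerkovichAffine ν d | ∀ i, (t i : WithTop ℝ) < w.val (MvPolynomial.X i)} := by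
  intro i
  have : (origin ν d).val (MvPolynomial.X i) = ν (MvPolynomial.constantCoeff (MvPolynomial.X i)) := rfl
  rw [this, MvPolynomial.constantCoeff_X, ν.map_zero]
  exact WithTop.coe_lt_top _

lemma isClosed_polydisc (m : Fin d → ℝ) :
    IsClosed {w : BerkovichAffine ν d | ∀ i, (m i : WithTop ℝ) ≤ w.val (MvPolynomial.X i)} := by
  simp only [Set.ofPred_forall]
  exact isClosed_iInter fun i => isClosed_le continuous_const (continuous_val _)

/-- On the polydisc each polynomial has value in some compact ray, so its values converge along an
ultrafilter. The valuation axioms pass to the limit. -/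
lemma isCompact_polydisc (m : Fin d → ℝ) :
    IsCompact {w : BerkovichAffine ν d | ∀ i, (m i : WithTop ℝ) ≤ w.val (MvPolynomial.X i)} := by
  rw [isCompact_iff_ultrafilter_le_nhds]
  intro 𝒰 h𝒰
  have hlim : ∀ P : MvPolynomial (Fin d) K, ∃ v : WithTop ℝ,
      Tendsto (fun w : BerkovichAffine ν d => w.val P) 𝒰 (𝓝 v) := by
    intro P
    obtain ⟨c, hc⟩ := WithTop.exists_real_lt
      (P.support.inf fun I => ν (P.coeff I) + ((∑ i, I i * m i : ℝ) : WithTop ℝ))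
    have hmem : Set.Ici (c : WithTop ℝ) ∈ (𝒰.map fun w : BerkovichAffine ν d => w.val P) := by
      refine Ultrafilter.mem_map.2 (mem_of_superset (le_principal_iff.1 h𝒰) fun w hw => ?_)
      refine w.le_val fun I => ?_
      by_cases hI : I ∈ P.support
      · exact (hc.le.trans (Finset.inf_le hI)).trans (by gcongr; exact coe_sum_nsmul_le hw I)
      · rw [MvPolynomial.notMem_support_iff.1 hI, ν.map_zero, WithTop.top_add]
        exact le_top
    obtain ⟨v, -, hv⟩ := isCompact_iff_ultrafilter_le_nhds.1 (WithTop.isCompact_Ici_coe c) _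
      (le_principal_iff.2 hmem)
    exact ⟨v, hv⟩
  choose v hv using hlim
  have hC : ∀ c, v (MvPolynomial.C c) = ν c := fun c => by
    refine tendsto_nhds_unique (hv (MvPolynomial.C c)) ?_
    simp only [val_C]
    exact tendsto_const_nhds
  let w' : BerkovichAffine ν d :=
    { val := AddValuation.of v
        (by rw [← map_zero MvPolynomial.C, hC, ν.map_zero])
        (by rw [← map_one MvPolynomial.C, hC, ν.map_one])
        (fun P Q => le_of_tendsto_of_tendsto' ((hv P).min (hv Q)) (hv (P + Q))
          fun w => w.val.map_add P Q)
        (fun P Q => tendsto_nhds_unique (hv (P * Q))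
          (((hv P).add (hv Q)).congr fun w => (w.val.map_mul P Q).symm))
      val_C := hC }
  have hle : (𝒰 : Filter (BerkovichAffine ν d)) ≤ 𝓝 w' := tendsto_nhds_iff (u := id).2 hv
  refine ⟨w', ?_, hle⟩
  exact (isClosed_polydisc m).mem_of_tendsto (f := id) hle (le_principal_iff.1 h𝒰)

end BerkovichAffine

/-! ### Values of power series and the induced map. -/

namespace BerkovichAffine

variable {K : Type*} [Field K] {ν : AddValuation K (WithTop ℝ)} {d : ℕ}

/-- The margin `1` beyond the growth rate `a` gives terms of degree at least `n` valuation at least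
`b + n`, so the truncations are Cauchy. -/
lemma exists_hasSeriesValue (w : BerkovichAffine ν d) {a : ℝ}
    (hw : ∀ i, ((a + 1 : ℝ) : WithTop ℝ) ≤ w.val (MvPolynomial.X i)) {g : MvPowerSeries (Fin d) K}
    (hg : IsDegreeBounded ν a g) : ∃ v, w.HasSeriesValue g v := by
  classical
  obtain ⟨b, hb⟩ := hg
  refine exists_tendsto_val (l := atTop) (u := seriesTrunc g) w.val fun M => ?_
  obtain ⟨n, hn⟩ := exists_nat_ge (M - b)
  have hn' := eventually_forall_degree_mem d n
  obtain ⟨S₀, hS₀⟩ := hn'.exists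
  refine ⟨S₀, hn'.mono fun S hS => ?_⟩
  refine le_trans ?_ (w.le_val_of_degree (a := a) (b := b) (n := n) (by linarith) hw (fun I => ?_)
    fun I hI => ?_)
  · exact_mod_cast (by linarith : M ≤ b + n * (a + 1 - a))
  · rw [MvPolynomial.coeff_sub]
    exact ν.map_le_sub (le_val_coeff_seriesTrunc hb S I) (le_val_coeff_seriesTrunc hb S₀ I)
  · rw [MvPolynomial.coeff_sub, coeff_seriesTrunc, coeff_seriesTrunc, if_pos (hS I hI),
      if_pos (hS₀ I hI), sub_self]

/-- The product of the truncations and the truncation of the product agree in low degrees, so their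
difference tends to `0`. -/
lemma HasSeriesValue.mul {w : BerkovichAffine ν d} {a : ℝ}
    (hw : ∀ i, ((a + 1 : ℝ) : WithTop ℝ) ≤ w.val (MvPolynomial.X i))
    {g h : MvPowerSeries (Fin d) K} (hg : IsDegreeBounded ν a g) (hh : IsDegreeBounded ν a h)
    {u v : WithTop ℝ} (hu : w.HasSeriesValue g u) (hv : w.HasSeriesValue h v) :
    w.HasSeriesValue (g * h) (u + v) := by
  classical
  obtain ⟨b, hb⟩ := hg
  obtain ⟨c, hc⟩ := hh
  refine tendsto_val_of_tendsto_val_sub (l := atTop) (w := fun _ => w.val)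
    (u := fun S => seriesTrunc g S * seriesTrunc h S) (u' := seriesTrunc (g * h))
    ((Tendsto.add hu hv).congr fun S => (w.val.map_mul _ _).symm) ?_
  rw [WithTop.tendsto_nhds_top_real]
  intro M
  obtain ⟨n, hn⟩ := exists_nat_ge (M - (b + c))
  filter_upwards [eventually_forall_degree_mem d n] with S hS
  refine le_trans ?_ (w.le_val_of_degree (a := a) (b := b + c) (n := n) (by linarith) hw
    (fun I => ?_) fun I hI => ?_)
  · exact_mod_cast (by linarith : M ≤ b + c + n * (a + 1 - a))
  · rw [MvPolynomial.coeff_sub]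
    refine ν.map_le_sub ?_ (le_val_coeff_seriesTrunc (le_val_coeff_mul hb hc) S I)
    have := le_val_coeff_mul (ν := ν) (a := a) (b := b) (c := c)
      (g := (seriesTrunc g S : MvPowerSeries (Fin d) K)) (h := (seriesTrunc h S : MvPowerSeries (Fin d) K))
      (fun I => by rw [MvPolynomial.coeff_coe]; exact le_val_coeff_seriesTrunc hb S I)
      (fun I => by rw [MvPolynomial.coeff_coe]; exact le_val_coeff_seriesTrunc hc S I) I
    rwa [← MvPolynomial.coe_mul, MvPolynomial.coeff_coe] at this
  · rw [MvPolynomial.coeff_sub, coeff_seriesTrunc, if_pos (hS I hI), MvPolynomial.coeff_mul,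
      MvPowerSeries.coeff_mul, sub_eq_zero]
    refine Finset.sum_congr rfl fun x hx => ?_
    have h1 : x.1 + x.2 = I := Finset.HasAntidiagonal.mem_antidiagonal.1 hx
    have h2 : x.1.degree + x.2.degree = I.degree := by rw [← map_add, h1]
    rw [coeff_seriesTrunc, coeff_seriesTrunc, if_pos (hS _ (by omega)), if_pos (hS _ (by omega))]

lemma hasSeriesValue_C (w : BerkovichAffine ν d) (c : K) :
    w.HasSeriesValue (MvPowerSeries.C c) (ν c) := by
  classical
  refine tendsto_const_nhds.congr' ?_
  filter_upwards [eventually_ge_atTop {(0 : Fin d →₀ ℕ)}] with S hS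
  have : seriesTrunc (MvPowerSeries.C (σ := Fin d) c) S = MvPolynomial.C c := by
    ext J
    rw [coeff_seriesTrunc, MvPowerSeries.coeff_C, MvPolynomial.coeff_C]
    by_cases hJ : J = 0
    · have h0 : (0 : Fin d →₀ ℕ) ∈ S := hS (Finset.mem_singleton_self _)
      simp [hJ, h0]
    · simp [hJ, Ne.symm hJ]
  change ν c = w.val (seriesTrunc (MvPowerSeries.C (σ := Fin d) c) S)
  rw [this, w.val_C]

lemma HasSeriesValue.min_le_add {w : BerkovichAffine ν d} {g h : MvPowerSeries (Fin d) K}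
    {u v z : WithTop ℝ} (hu : w.HasSeriesValue g u) (hv : w.HasSeriesValue h v)
    (hz : w.HasSeriesValue (g + h) z) : min u v ≤ z := by
  refine le_of_tendsto_of_tendsto' (Tendsto.min hu hv) hz fun S => ?_
  simp only [map_add, Finset.sum_add_distrib]
  exact w.val.map_add _ _

/-- Series of bounded growth define a map on a polydisc. -/
lemma exists_mapsTo {F : Fin d → MvPowerSeries (Fin d) K} {a : ℝ}
    (hF : ∀ i, IsDegreeBounded ν a (F i)) (w : BerkovichAffine ν d)
    (hw : ∀ i, ((a + 1 : ℝ) : WithTop ℝ) ≤ w.val (MvPolynomial.X i)) : ∃ w', MapsTo F w w' := by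
  choose v hv using fun P => exists_hasSeriesValue w hw (isDegreeBounded_aeval hF P)
  have hC : ∀ c, v (MvPolynomial.C c) = ν c := fun c => by
    have h1 := hv (MvPolynomial.C c)
    rw [MvPolynomial.aeval_C] at h1
    exact tendsto_nhds_unique h1 (hasSeriesValue_C w c)
  refine ⟨⟨AddValuation.of v ?_ ?_ ?_ ?_, hC⟩, hv⟩
  · rw [← map_zero MvPolynomial.C, hC, ν.map_zero]
  · rw [← map_one MvPolynomial.C, hC, ν.map_one]
  · intro P Q
    have h1 := hv (P + Q)
    rw [map_add] at h1
    exact (hv P).min_le_add (hv Q) h1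
  · intro P Q
    have h1 := hv (P * Q)
    rw [map_mul] at h1
    exact tendsto_nhds_unique h1 (HasSeriesValue.mul hw (isDegreeBounded_aeval hF P)
      (isDegreeBounded_aeval hF Q) (hv P) (hv Q))

lemma MapsTo.le_val_X {F : Fin d → MvPowerSeries (Fin d) K} {w w' : BerkovichAffine ν d}
    (h : MapsTo F w w') {i : Fin d} {m : WithTop ℝ}
    (hm : ∀ I, m ≤ ν (MvPowerSeries.coeff I (F i)) + ∑ j, I j • w.val (MvPolynomial.X j)) :
    m ≤ w'.val (MvPolynomial.X i) := by
  have h1 := h (MvPolynomial.X i)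
  rw [MvPolynomial.aeval_X] at h1
  refine ge_of_tendsto' h1 fun S => w.val.map_le_sum fun I _ => ?_
  rw [val_monomial]
  exact hm I

end BerkovichAffine

/-! ### Contraction of all lifts. -/

section Lifts

variable {K : Type*} [Field K] {ν : AddValuation K (WithTop ℝ)} {d : ℕ}

lemma IsLift.exists_isDegreeBounded {f : Fin d → TropSeries d} (hf : IsConvergentTropGerm f) :
    ∃ a : ℝ, ∀ F : Fin d → MvPowerSeries (Fin d) K, IsLift ν f F →
      ∀ i, IsDegreeBounded ν a (F i) := by
  obtain ⟨a, b, -, hab⟩ := hf.coeff_ge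
  exact ⟨a, fun F hF i => ⟨b, fun I => by rw [(hF i).2]; exact hab i I⟩⟩

lemma IsLift.isContractingAnalyticGerm_of_potential {f : Fin d → TropSeries d}
    (hf : IsConvergentTropGerm f) {F : Fin d → MvPowerSeries (Fin d) K} (hF : IsLift ν f F)
    {p : Fin d → ℝ} {ε : ℝ} (hε : 0 < ε)
    (hp : ∀ i j, ((p i + ε : ℝ) : WithTop ℝ) ≤ tropLinearPart f i j + p j) :
    IsContractingAnalyticGerm ν F := by
  obtain ⟨t₀, ht₀⟩ := term_ge_of_potential hf hp
  obtain ⟨a, ha⟩ := IsLift.exists_isDegreeBounded (K := K) (ν := ν) hf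
  intro U hU
  obtain ⟨t₁, ht₁⟩ := BerkovichAffine.exists_polydisc_subset hU
  set r : ℝ := max t₀ (max t₁ (a + 1) + ∑ i, |p i|) with hr
  have hpr : ∀ i, max t₁ (a + 1) ≤ p i + r := fun i => by
    have h1 := neg_abs_le (p i)
    have h2 : |p i| ≤ ∑ i, |p i| :=
      Finset.single_le_sum (f := fun i => |p i|) (fun i _ => abs_nonneg _) (Finset.mem_univ i)
    have h3 := le_max_right t₀ (max t₁ (a + 1) + ∑ i, |p i|)
    rw [← hr] at h3
    linarith
  let V : Set (BerkovichAffine ν d) :=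
    {w | ∀ i, ((p i + r : ℝ) : WithTop ℝ) < w.val (MvPolynomial.X i)}
  let C : Set (BerkovichAffine ν d) :=
    {w | ∀ i, ((p i + r + ε : ℝ) : WithTop ℝ) ≤ w.val (MvPolynomial.X i)}
  have hcl : closure {y | ∃ x ∈ V, BerkovichAffine.MapsTo F x y} ⊆ C := by
    refine closure_minimal ?_ (BerkovichAffine.isClosed_polydisc _)
    rintro y ⟨x, hx, hxy⟩ i
    refine hxy.le_val_X fun I => ?_
    rw [(hF i).2]
    exact ht₀ r (le_max_left _ _) (fun j => x.val (MvPolynomial.X j)) (fun i => (hx i).le) i I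
  refine ⟨V, fun w hw => ht₁ w fun i => le_trans ?_ (hw i).le, BerkovichAffine.isOpen_polydisc _,
    BerkovichAffine.origin_mem_polydisc _, fun w hw => BerkovichAffine.exists_mapsTo (ha F hF) w
      fun i => le_trans ?_ (hw i).le, (BerkovichAffine.isCompact_polydisc _).of_isClosed_subset
    isClosed_closure hcl, hcl.trans fun y hy i => lt_of_lt_of_le ?_ (hy i)⟩
  · exact_mod_cast (le_max_left _ _).trans (hpr i)
  · exact_mod_cast (le_max_right _ _).trans (hpr i)
  · exact_mod_cast (by linarith : p i + r < p i + r + ε)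

end Lifts

/-! ### Weighted Gauss valuations. -/

section GaussPoints

variable {K : Type*} [Field K] (ν : AddValuation K (WithTop ℝ)) {d : ℕ} (x : Fin d → ℝ)

/-- The weighted Gauss valuation of a polynomial: the minimum of the valuations of its terms at a
point whose coordinates have valuations `x_i`. -/
noncomputable def gaussValue (P : MvPolynomial (Fin d) K) : WithTop ℝ :=
  P.support.inf fun I => ν (P.coeff I) + ((∑ i, I i * x i : ℝ) : WithTop ℝ)

lemma le_gaussValue_iff {m : WithTop ℝ} {P : MvPolynomial (Fin d) K} :
    m ≤ gaussValue ν x P ↔ ∀ I, m ≤ ν (P.coeff I) + ((∑ i, I i * x i : ℝ) : WithTop ℝ) := by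
  rw [gaussValue, Finset.le_inf_iff]
  refine ⟨fun h I => ?_, fun h I _ => h I⟩
  by_cases hI : I ∈ P.support
  · exact h I hI
  · rw [MvPolynomial.notMem_support_iff.1 hI, ν.map_zero, WithTop.top_add]
    exact le_top

lemma gaussValue_le (P : MvPolynomial (Fin d) K) (I : Fin d →₀ ℕ) :
    gaussValue ν x P ≤ ν (P.coeff I) + ((∑ i, I i * x i : ℝ) : WithTop ℝ) :=
  (le_gaussValue_iff ν x).1 le_rfl I

lemma gaussValue_C (c : K) : gaussValue ν x (MvPolynomial.C c) = ν c := by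
  classical
  refine le_antisymm ?_ ((le_gaussValue_iff ν x).2 fun I => ?_)
  · simpa using gaussValue_le ν x (MvPolynomial.C c) 0
  · rw [MvPolynomial.coeff_C]
    split_ifs with h
    · simp [← h]
    · simp

lemma min_gaussValue_le_add (P Q : MvPolynomial (Fin d) K) :
    min (gaussValue ν x P) (gaussValue ν x Q) ≤ gaussValue ν x (P + Q) := by
  refine (le_gaussValue_iff ν x).2 fun I => ?_
  rw [MvPolynomial.coeff_add]
  refine le_trans ?_ (add_le_add_left (ν.map_add _ _) _)
  rw [← min_add_add_right]
  exact min_le_min (gaussValue_le ν x P I) (gaussValue_le ν x Q I)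

/-- A lexicographically minimal exponent at which the Gauss valuation is attained. -/
lemma exists_lex_min_term {P : MvPolynomial (Fin d) K} (hP : P ≠ 0) :
    gaussValue ν x P ≠ ⊤ ∧ ∃ I₀ : Fin d →₀ ℕ,
      ν (P.coeff I₀) + ((∑ i, I₀ i * x i : ℝ) : WithTop ℝ) = gaussValue ν x P ∧
      ∀ I : Fin d →₀ ℕ, toLex I < toLex I₀ →
        gaussValue ν x P < ν (P.coeff I) + ((∑ i, I i * x i : ℝ) : WithTop ℝ) := by
  classical
  have hne : P.support.Nonempty := MvPolynomial.support_nonempty.2 hP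
  have htop : gaussValue ν x P ≠ ⊤ := by
    obtain ⟨I, hI⟩ := hne
    refine ne_top_of_le_ne_top ?_ (gaussValue_le ν x P I)
    rw [WithTop.add_ne_top]
    exact ⟨ν.ne_top_iff.2 (MvPolynomial.mem_support_iff.1 hI), WithTop.coe_ne_top⟩
  refine ⟨htop, ?_⟩
  let S := P.support.filter fun I =>
    ν (P.coeff I) + ((∑ i, I i * x i : ℝ) : WithTop ℝ) = gaussValue ν x P
  have hS : S.Nonempty := by
    obtain ⟨I, hI, h⟩ := Finset.exists_mem_eq_inf P.support hne
      fun I => ν (P.coeff I) + ((∑ i, I i * x i : ℝ) : WithTop ℝ)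
    exact ⟨I, Finset.mem_filter.2 ⟨hI, h.symm⟩⟩
  obtain ⟨I₀, hI₀, hmin⟩ := S.exists_min_image toLex hS
  refine ⟨I₀, (Finset.mem_filter.1 hI₀).2, fun I hI => ?_⟩
  refine (gaussValue_le ν x P I).lt_of_ne fun heq => ?_
  have hIS : I ∈ S := by
    refine Finset.mem_filter.2 ⟨MvPolynomial.mem_support_iff.2 fun h0 => htop ?_, heq.symm⟩
    rw [heq, h0, ν.map_zero, WithTop.top_add]
  exact absurd (hmin I hIS) (not_le.2 hI)

/-- This is Gauss's lemma. The product of the lexicographically first minimal terms of `P` and `Q`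
is the unique lowest contribution to its coefficient in `P * Q`, so it does not cancel. -/
lemma gaussValue_mul (P Q : MvPolynomial (Fin d) K) :
    gaussValue ν x (P * Q) = gaussValue ν x P + gaussValue ν x Q := by
  classical
  have hterm : ∀ I J : Fin d →₀ ℕ, ν (P.coeff I * Q.coeff J) +
      ((∑ i, (I + J) i * x i : ℝ) : WithTop ℝ) =
      (ν (P.coeff I) + ((∑ i, I i * x i : ℝ) : WithTop ℝ)) +
        (ν (Q.coeff J) + ((∑ i, J i * x i : ℝ) : WithTop ℝ)) := by
    intro I J
    have : ∑ i, ((I + J) i : ℝ) * x i = ∑ i, I i * x i + ∑ i, J i * x i := by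
      rw [← Finset.sum_add_distrib]
      refine Finset.sum_congr rfl fun i _ => ?_
      rw [Finsupp.add_apply, Nat.cast_add, add_mul]
    rw [this, ν.map_mul, WithTop.coe_add, add_add_add_comm]
  refine le_antisymm ?_ ?_
  · by_cases hP : P = 0
    · rw [hP, ← map_zero MvPolynomial.C, gaussValue_C, ν.map_zero, WithTop.top_add]; exact le_top
    by_cases hQ : Q = 0
    · rw [hQ, ← map_zero MvPolynomial.C, gaussValue_C, ν.map_zero, WithTop.add_top]; exact le_top
    obtain ⟨hPt, I₀, hI₀, hI⟩ := exists_lex_min_term ν x hP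
    obtain ⟨hQt, J₀, hJ₀, hJ⟩ := exists_lex_min_term ν x hQ
    refine (gaussValue_le ν x (P * Q) (I₀ + J₀)).trans ?_
    rw [← hI₀, ← hJ₀, ← hterm]
    refine add_le_add_left (le_of_eq ?_) _
    have hmem : (I₀, J₀) ∈ Finset.HasAntidiagonal.antidiagonal (I₀ + J₀) :=
      Finset.HasAntidiagonal.mem_antidiagonal.2 rfl
    rw [MvPolynomial.coeff_mul, ← Finset.add_sum_erase _ _ hmem]
    have hmain : ν (P.coeff I₀ * Q.coeff J₀) ≠ ⊤ := by
      intro h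
      have := hterm I₀ J₀
      rw [h, WithTop.top_add, hI₀, hJ₀, eq_comm, WithTop.add_eq_top] at this
      exact this.elim hPt hQt
    refine ν.map_add_eq_of_lt_left (ν.map_lt_sum hmain fun y hy => ?_)
    obtain ⟨hy1, hy2⟩ := Finset.mem_erase.1 hy
    have hsum : y.1 + y.2 = I₀ + J₀ := Finset.HasAntidiagonal.mem_antidiagonal.1 hy2
    refine lt_of_add_lt_add_right (a := ((∑ i, (I₀ + J₀) i * x i : ℝ) : WithTop ℝ)) ?_
    conv_rhs => rw [← hsum]
    rw [hterm, hterm, hI₀, hJ₀]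
    rcases lt_trichotomy (toLex y.1) (toLex I₀) with h | h | h
    · exact WithTop.add_lt_add_of_lt_of_le hQt (hI _ h) (gaussValue_le ν x Q _)
    · have h1 : y.1 = I₀ := h
      rw [h1] at hsum
      exact absurd (Prod.ext h1 (add_left_cancel hsum)) hy1
    · have h2 : toLex y.2 < toLex J₀ := by
        by_contra hcon
        have := add_lt_add_of_lt_of_le h (not_lt.1 hcon)
        rw [← toLex_add, ← toLex_add, hsum] at this
        exact lt_irrefl _ this
      exact WithTop.add_lt_add_of_le_of_lt hPt (gaussValue_le ν x P _) (hJ _ h2)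
  · refine (le_gaussValue_iff ν x).2 fun I => ?_
    rw [MvPolynomial.coeff_mul]
    have h : gaussValue ν x P + gaussValue ν x Q + ((-∑ i, I i * x i : ℝ) : WithTop ℝ) ≤
        ν (∑ y ∈ Finset.HasAntidiagonal.antidiagonal I, P.coeff y.1 * Q.coeff y.2) := by
      refine ν.map_le_sum fun y hy => ?_
      have hsum : y.1 + y.2 = I := Finset.HasAntidiagonal.mem_antidiagonal.1 hy
      refine (add_le_add_left (add_le_add (gaussValue_le ν x P y.1) (gaussValue_le ν x Q y.2)) _).trans
        (le_of_eq ?_)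
      rw [← hterm, hsum, add_assoc, ← WithTop.coe_add, add_neg_cancel, WithTop.coe_zero, add_zero]
    refine le_trans (le_of_eq ?_) (add_le_add_left h _)
    rw [add_assoc, ← WithTop.coe_add, neg_add_cancel, WithTop.coe_zero, add_zero]

/-- The Gauss point of the polydisc with radii of valuations `x_i`. -/
noncomputable def gaussPoint : BerkovichAffine ν d where
  val := AddValuation.of (gaussValue ν x)
    (by rw [← map_zero MvPolynomial.C, gaussValue_C, ν.map_zero])
    (by rw [← map_one MvPolynomial.C, gaussValue_C, ν.map_one])
    (min_gaussValue_le_add ν x) (gaussValue_mul ν x)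
  val_C := gaussValue_C ν x

lemma gaussPoint_val (P : MvPolynomial (Fin d) K) :
    (gaussPoint ν x).val P = gaussValue ν x P := rfl

lemma gaussPoint_val_le (P : MvPolynomial (Fin d) K) (j : Fin d) :
    (gaussPoint ν x).val P ≤ ν (P.coeff (Finsupp.single j 1)) + x j := by
  refine (gaussValue_le ν x P (Finsupp.single j 1)).trans_eq ?_
  congr 2
  rw [Finset.sum_eq_single j]
  · simp
  · intro i _ hij
    simp [hij.symm]
  · simp

lemma le_gaussPoint_val_X (i : Fin d) :
    (x i : WithTop ℝ) ≤ (gaussPoint ν x).val (MvPolynomial.X i) := by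
  classical
  rw [gaussPoint_val, le_gaussValue_iff]
  intro I
  rw [MvPolynomial.coeff_X]
  split_ifs with h
  · rw [← h, Finset.sum_eq_single i]
    · simp
    · intro j _ hij
      simp [hij.symm]
    · simp
  · simp

end GaussPoints

/-! ### Powers of a matrix and its characteristic polynomial. -/

section CharpolyBound

variable {K : Type*} [Field K] (ν : AddValuation K (WithTop ℝ))

/-- The Gauss valuation on `K[X]` for which `X` has valuation `μ`. -/
lemma exists_polynomial_gauss (μ : ℝ) : ∃ v : AddValuation (Polynomial K) (WithTop ℝ),
    (∀ c, v (Polynomial.C c) = ν c) ∧ (μ : WithTop ℝ) ≤ v Polynomial.X ∧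
      ∀ (P : Polynomial K) (k : ℕ), v P ≤ ν (P.coeff k) + ((k * μ : ℝ) : WithTop ℝ) := by
  classical
  let φ : Polynomial K →+* MvPolynomial (Fin 1) K :=
    (Polynomial.aeval (MvPolynomial.X 0 : MvPolynomial (Fin 1) K)).toRingHom
  let w := gaussPoint ν fun _ : Fin 1 => μ
  have hφC : ∀ c, φ (Polynomial.C c) = MvPolynomial.C c := fun c => Polynomial.aeval_C _ c
  have hφX : φ Polynomial.X = MvPolynomial.X 0 := Polynomial.aeval_X _
  have hcoeff : ∀ (P : Polynomial K) (k : ℕ), (φ P).coeff (Finsupp.single 0 k) = P.coeff k := by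
    intro P k
    change (Polynomial.aeval (MvPolynomial.X 0 : MvPolynomial (Fin 1) K) P).coeff _ = _
    rw [Polynomial.aeval_eq_sum_range' (n := max (P.natDegree + 1) (k + 1)) (by omega),
      MvPolynomial.coeff_sum, Finset.sum_eq_single k]
    · rw [MvPolynomial.X_pow_eq_monomial, MvPolynomial.coeff_smul, MvPolynomial.coeff_monomial,
        if_pos rfl, smul_eq_mul, mul_one]
    · intro b _ hb
      rw [MvPolynomial.X_pow_eq_monomial, MvPolynomial.coeff_smul, MvPolynomial.coeff_monomial,
        if_neg, smul_zero]
      exact fun h => hb (Finsupp.single_injective 0 h)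
    · intro h
      exact absurd (Finset.mem_range.2 (by omega)) h
  refine ⟨w.val.comap φ, fun c => ?_, ?_, fun P k => ?_⟩
  · change w.val (φ _) = _
    rw [hφC, w.val_C]
  · change _ ≤ w.val (φ _)
    rw [hφX]
    exact le_gaussPoint_val_X ν (fun _ : Fin 1 => μ) 0
  · refine (gaussValue_le ν (fun _ : Fin 1 => μ) (φ P) (Finsupp.single 0 k)).trans_eq ?_
    rw [hcoeff]
    simp

/-- If the entries of a power of a matrix have large valuations, so have the coefficients of the
characteristic polynomial. -/
lemma le_val_charpoly_coeff {d : ℕ} (A : Matrix (Fin d) (Fin d) K) {n : ℕ} (hn : 0 < n) {μ : ℝ}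
    (hA : ∀ i j, ((n * μ : ℝ) : WithTop ℝ) ≤ ν ((A ^ n) i j)) (k : ℕ) :
    ((d * μ : ℝ) : WithTop ℝ) ≤ ν (A.charpoly.coeff k) + ((k * μ : ℝ) : WithTop ℝ) := by
  classical
  obtain ⟨v, hvC, hvX, hv⟩ := exists_polynomial_gauss ν μ
  set Y : Matrix (Fin d) (Fin d) (Polynomial K) := Matrix.scalar (Fin d) Polynomial.X with hY
  set B : Matrix (Fin d) (Fin d) (Polynomial K) := A.map Polynomial.C with hB
  have hcomm : Commute Y B := Matrix.scalar_commute _ (fun r => Commute.all _ r) _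
  set S := ∑ i ∈ Finset.range n, Y ^ i * B ^ (n - 1 - i)
  -- On determinants this says that `χ_A(X) * det S = χ_{A^n}(X^n)`. The Gauss valuation of the
  -- right side is at least `d * n * μ`. As `det S` is monic of degree `d * n - d`, its valuation is
  -- at most `(d * n - d) * μ`, which leaves at least `d * μ` for `χ_A`.
  have hfac : (Y - B) * S = Y ^ n - B ^ n := hcomm.mul_geom_sum₂ n
  have hdet : A.charpoly * S.det = (Y ^ n - B ^ n).det := by
    rw [← hfac, Matrix.det_mul]; rfl
  have hBn : B ^ n = (A ^ n).map Polynomial.C := by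
    rw [hB]
    exact (map_pow (RingHom.mapMatrix Polynomial.C) A n).symm
  have hYn : Y ^ n = Matrix.scalar (Fin d) (Polynomial.X ^ n) := by
    rw [hY, ← map_pow]
  have hexp : (Y ^ n - B ^ n).det = Polynomial.expand K n (A ^ n).charpoly := by
    rw [Matrix.charpoly, AlgHom.map_det]
    congr 1
    ext1 i j
    simp only [Matrix.charmatrix, AlgHom.mapMatrix_apply, Matrix.map_apply, Matrix.sub_apply,
      RingHom.mapMatrix_apply, map_sub, Polynomial.expand_C, hYn, hBn]
    congr 1
    by_cases hij : i = j
    · simp [hij]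
    · simp [hij]
  have hDmonic : (Y ^ n - B ^ n).det.Monic := by
    rw [hexp]; exact (Matrix.charpoly_monic _).expand hn
  have hDdeg : (Y ^ n - B ^ n).det.natDegree = d * n := by
    rw [hexp, Polynomial.natDegree_expand, Matrix.charpoly_natDegree_eq_dim, Fintype.card_fin]
  have hSmonic : S.det.Monic := (Matrix.charpoly_monic A).of_mul_monic_left (hdet ▸ hDmonic)
  have hSdeg : d + S.det.natDegree = d * n := by
    rw [← hDdeg, ← hdet, (Matrix.charpoly_monic A).natDegree_mul hSmonic,
      Matrix.charpoly_natDegree_eq_dim, Fintype.card_fin]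
  have hvS : v S.det ≤ ((S.det.natDegree * μ : ℝ) : WithTop ℝ) := by
    have := hv S.det S.det.natDegree
    rwa [hSmonic.coeff_natDegree, ν.map_one, zero_add] at this
  have hvD : ((d * (n * μ) : ℝ) : WithTop ℝ) ≤ v (Y ^ n - B ^ n).det := by
    rw [Matrix.det_apply']
    refine v.map_le_sum fun σ _ => ?_
    have hent : ∀ i j, ((n * μ : ℝ) : WithTop ℝ) ≤ v ((Y ^ n - B ^ n) i j) := by
      intro i j
      rw [Matrix.sub_apply]
      refine v.map_le_sub ?_ ?_
      · rw [hYn, Matrix.scalar_apply, Matrix.diagonal_apply]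
        split_ifs
        · rw [v.map_pow, ← nsmul_eq_mul, WithTop.coe_nsmul]
          exact nsmul_le_nsmul_right hvX n
        · rw [v.map_zero]; exact le_top
      · rw [hBn, Matrix.map_apply, hvC]
        exact hA i j
    have hprod : ∀ s : Finset (Fin d), ((s.card * (n * μ) : ℝ) : WithTop ℝ) ≤
        v (∏ i ∈ s, (Y ^ n - B ^ n) (σ i) i) := by
      intro s
      induction s using Finset.induction_on with
      | empty => simp
      | insert i s hi ih =>
        rw [Finset.prod_insert hi, v.map_mul, Finset.card_insert_of_notMem hi]
        refine le_trans (le_of_eq ?_) (add_le_add (hent _ _) ih)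
        rw [← WithTop.coe_add]
        congr 1
        push_cast
        ring
    have h1 := hprod Finset.univ
    rw [Finset.card_univ, Fintype.card_fin] at h1
    rw [v.map_mul]
    refine h1.trans (le_add_of_nonneg_left ?_)
    rcases Int.units_eq_one_or (Equiv.Perm.sign σ) with h | h <;> rw [h] <;>
      simp [v.map_neg]
  have hχ : ((d * μ : ℝ) : WithTop ℝ) ≤ v A.charpoly := by
    rw [← hdet, v.map_mul] at hvD
    have h1 := hvD.trans (add_le_add_right hvS _)
    rw [← WithTop.add_le_add_iff_right (WithTop.coe_ne_top (a := (S.det.natDegree * μ : ℝ)))]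
    refine le_trans (le_of_eq ?_) h1
    rw [← WithTop.coe_add]
    congr 1
    have : (d : ℝ) + S.det.natDegree = d * n := by exact_mod_cast hSdeg
    linear_combination μ * this
  exact hχ.trans (hv _ k)

end CharpolyBound

/-! ### Linear parts and iterates of Gauss points. -/

section LinearPart

variable {K : Type*} [Field K] {ν : AddValuation K (WithTop ℝ)} {d : ℕ}

/-- The linear part of a tuple of power series. -/
noncomputable def linearPart (F : Fin d → MvPowerSeries (Fin d) K) : Matrix (Fin d) (Fin d) K :=
  Matrix.of fun i j => MvPowerSeries.coeff (Finsupp.single j 1) (F i)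

lemma coeff_single_mul (g h : MvPowerSeries (Fin d) K) (j : Fin d) :
    MvPowerSeries.coeff (Finsupp.single j 1) (g * h) =
      MvPowerSeries.coeff 0 g * MvPowerSeries.coeff (Finsupp.single j 1) h +
        MvPowerSeries.coeff (Finsupp.single j 1) g * MvPowerSeries.coeff 0 h := by
  classical
  rw [MvPowerSeries.coeff_mul, Finsupp.antidiagonal_single, Finset.sum_map,
    Finset.Nat.antidiagonal_succ]
  simp

/-- This is the chain rule at the origin: composition with `F` acts on linear forms through the
matrix of `F`. -/
lemma coeff_aeval {F : Fin d → MvPowerSeries (Fin d) K}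
    (hF : ∀ i, MvPowerSeries.coeff 0 (F i) = 0) (P : MvPolynomial (Fin d) K) :
    MvPowerSeries.coeff 0 (MvPolynomial.aeval F P) = P.coeff 0 ∧
    ∀ j, MvPowerSeries.coeff (Finsupp.single j 1) (MvPolynomial.aeval F P) =
      Matrix.vecMul (fun i => P.coeff (Finsupp.single i 1)) (linearPart F) j := by
  classical
  have hpoly : ∀ (p q : MvPolynomial (Fin d) K) (k : Fin d),
      (p * q).coeff (Finsupp.single k 1) = p.coeff 0 * q.coeff (Finsupp.single k 1) +
        p.coeff (Finsupp.single k 1) * q.coeff 0 := by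
    intro p q k
    rw [← MvPolynomial.coeff_coe (p * q), MvPolynomial.coe_mul]
    simpa [MvPolynomial.coeff_coe] using
      coeff_single_mul (p : MvPowerSeries (Fin d) K) (q : MvPowerSeries (Fin d) K) k
  induction P using MvPolynomial.induction_on with
  | C c =>
    rw [MvPolynomial.aeval_C]
    refine ⟨by simp [MvPowerSeries.algebraMap_apply], fun j => ?_⟩
    have h0 : ∀ i : Fin d, (Finsupp.single i 1 : Fin d →₀ ℕ) ≠ 0 := fun i => by simp
    simp [MvPowerSeries.algebraMap_apply, MvPowerSeries.coeff_C, MvPolynomial.coeff_C, h0,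
      (h0 _).symm, Matrix.vecMul, dotProduct]
  | add p q hp hq =>
    refine ⟨by rw [map_add, map_add, hp.1, hq.1, MvPolynomial.coeff_add], fun j => ?_⟩
    rw [map_add, map_add, hp.2, hq.2]
    simp only [MvPolynomial.coeff_add, Matrix.vecMul, dotProduct, add_mul, Finset.sum_add_distrib]
  | mul_X p i hp =>
    refine ⟨?_, fun j => ?_⟩
    · rw [map_mul, MvPolynomial.aeval_X, MvPowerSeries.coeff_zero_eq_constantCoeff_apply, map_mul,
        ← MvPowerSeries.coeff_zero_eq_constantCoeff_apply,
        ← MvPowerSeries.coeff_zero_eq_constantCoeff_apply, hF, mul_zero]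
      change 0 = MvPolynomial.constantCoeff (p * MvPolynomial.X i)
      rw [map_mul, MvPolynomial.constantCoeff_X, mul_zero]
    · rw [map_mul, MvPolynomial.aeval_X, coeff_single_mul, hF, mul_zero, add_zero, hp.1]
      simp only [hpoly, Matrix.vecMul, dotProduct]
      rw [Finset.sum_eq_single i]
      · simp [linearPart]
      · intro k _ hk
        have : (Finsupp.single i 1 : Fin d →₀ ℕ) ≠ Finsupp.single k 1 := fun h =>
          hk (Finsupp.single_left_injective one_ne_zero h).symm
        simp [MvPolynomial.coeff_X, this]
      · simp

/-- An upper bound for the images of a Gauss point under the iterates of a germ. -/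
lemma val_iterate_le {F : Fin d → MvPowerSeries (Fin d) K}
    (hF : ∀ i, MvPowerSeries.coeff 0 (F i) = 0) {x : Fin d → ℝ} {z : ℕ → BerkovichAffine ν d}
    (hz0 : z 0 = gaussPoint ν x) (hz : ∀ n, BerkovichAffine.MapsTo F (z n) (z (n + 1))) (n : ℕ) :
    ∀ (P : MvPolynomial (Fin d) K) (j : Fin d), (z n).val P ≤
      ν (Matrix.vecMul (fun i => P.coeff (Finsupp.single i 1)) (linearPart F ^ n) j) + x j := by
  classical
  induction n with
  | zero =>
    intro P j
    rw [hz0, pow_zero, Matrix.vecMul_one]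
    exact gaussPoint_val_le ν x P j
  | succ n ih =>
    intro P j
    refine le_of_tendsto (hz n P) ?_
    filter_upwards [eventually_forall_degree_mem d 2] with S hS
    refine (ih (seriesTrunc (MvPolynomial.aeval F P) S) j).trans_eq ?_
    have h1 : (fun i => (seriesTrunc (MvPolynomial.aeval F P) S).coeff (Finsupp.single i 1)) =
        Matrix.vecMul (fun i => P.coeff (Finsupp.single i 1)) (linearPart F) := by
      ext i
      rw [coeff_seriesTrunc, if_pos (hS _ (by simp)), (coeff_aeval hF P).2]
    rw [h1, Matrix.vecMul_vecMul, ← pow_succ']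

lemma val_X_iterate_le {F : Fin d → MvPowerSeries (Fin d) K}
    (hF : ∀ i, MvPowerSeries.coeff 0 (F i) = 0) {x : Fin d → ℝ} {z : ℕ → BerkovichAffine ν d}
    (hz0 : z 0 = gaussPoint ν x) (hz : ∀ n, BerkovichAffine.MapsTo F (z n) (z (n + 1))) (n : ℕ)
    (i j : Fin d) :
    (z n).val (MvPolynomial.X i) ≤ ν ((linearPart F ^ n) i j) + x j := by
  classical
  refine (val_iterate_le hF hz0 hz n (MvPolynomial.X i) j).trans_eq ?_
  have h1 : (fun k => (MvPolynomial.X i : MvPolynomial (Fin d) K).coeff (Finsupp.single k 1)) =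
      Pi.single i 1 := by
    ext k
    rw [MvPolynomial.coeff_X, Pi.single_apply]
    refine if_congr ?_ rfl rfl
    exact ⟨fun h => (Finsupp.single_left_injective one_ne_zero h).symm, fun h => by rw [h]⟩
  rw [h1, Matrix.single_one_vecMul]
  rfl

end LinearPart

/-! ### Concave functions with values in the tropical numbers. -/

section Concavity

/-- The function `g` with values in `ℝ ∪ {∞}` is concave on `(t, ∞)`. -/
def IsConcaveBeyond (t : ℝ) (g : ℝ → WithTop ℝ) : Prop :=
  ∀ r₁ > t, ∀ r₂ > t, ∀ α β : ℝ, 0 ≤ α → 0 ≤ β → α + β = 1 → ∀ m₁ m₂ : ℝ,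
    (m₁ : WithTop ℝ) ≤ g r₁ → (m₂ : WithTop ℝ) ≤ g r₂ →
      ((α * m₁ + β * m₂ : ℝ) : WithTop ℝ) ≤ g (α * r₁ + β * r₂)

lemma combination_gt {t r₁ r₂ α β : ℝ} (h₁ : t < r₁) (h₂ : t < r₂) (hα : 0 ≤ α) (hβ : 0 ≤ β)
    (h : α + β = 1) : t < α * r₁ + β * r₂ := by
  have := convex_Ioi t h₁ h₂ hα hβ h
  simpa using this

lemma IsConcaveBeyond.of_tendsto {t : ℝ} {α : Type*} {l : Filter α} [l.NeBot]
    {g : α → ℝ → WithTop ℝ} {G : ℝ → WithTop ℝ} (hg : ∀ s, IsConcaveBeyond t (g s))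
    (hG : ∀ r > t, Tendsto (fun s => g s r) l (𝓝 (G r))) : IsConcaveBeyond t G := by
  intro r₁ h₁ r₂ h₂ α β hα hβ hαβ m₁ m₂ hm₁ hm₂
  -- The loss `δ` is needed because a lower bound for the limit only holds approximately along the
  -- filter.
  have key : ∀ δ : ℝ, 0 < δ → ((α * m₁ + β * m₂ - δ : ℝ) : WithTop ℝ) ≤ G (α * r₁ + β * r₂) := by
    intro δ hδ
    have e1 : ∀ᶠ s in l, ((m₁ - δ : ℝ) : WithTop ℝ) < g s r₁ :=
      (hG r₁ h₁).eventually (lt_mem_nhds (lt_of_lt_of_le (by exact_mod_cast sub_lt_self _ hδ) hm₁))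
    have e2 : ∀ᶠ s in l, ((m₂ - δ : ℝ) : WithTop ℝ) < g s r₂ :=
      (hG r₂ h₂).eventually (lt_mem_nhds (lt_of_lt_of_le (by exact_mod_cast sub_lt_self _ hδ) hm₂))
    refine ge_of_tendsto (hG _ (combination_gt h₁ h₂ hα hβ hαβ)) ?_
    filter_upwards [e1, e2] with s hs1 hs2
    refine le_trans (le_of_eq ?_) (hg s r₁ h₁ r₂ h₂ α β hα hβ hαβ _ _ hs1.le hs2.le)
    congr 1
    linear_combination δ * hαβ
  refine le_of_forall_lt_imp_le_of_dense fun c hc => ?_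
  induction c with
  | top => exact absurd hc (by simp)
  | coe c =>
    have hc' : c < α * m₁ + β * m₂ := by exact_mod_cast hc
    have := key (α * m₁ + β * m₂ - c) (by linarith)
    rwa [sub_sub_cancel] at this

lemma IsConcaveBeyond.eq_top {t : ℝ} {G : ℝ → WithTop ℝ} (hG : IsConcaveBeyond t G) {r₀ : ℝ}
    (hr₀ : t < r₀) (h0 : G r₀ = ⊤) {r : ℝ} (hr : t < r) : G r = ⊤ := by
  -- Chosen so small that `r + η * (r - r₀)` stays beyond `t`. Then `r` is a convex combination of
  -- this point and `r₀`, with positive weight at `r₀`, and an infinite value there forces one at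
  -- `r`.
  set η : ℝ := (r - t) / (2 * (|r - r₀| + 1)) with hη
  have hab : 0 < |r - r₀| + 1 := by positivity
  have hη0 : 0 < η := div_pos (by linarith) (by linarith)
  have hηb : η * |r - r₀| < r - t := by
    have h1 : η * (2 * (|r - r₀| + 1)) = r - t := div_mul_cancel₀ _ (by positivity)
    have h2 : 0 ≤ η * |r - r₀| := by positivity
    nlinarith
  have hr₂ : t < r + η * (r - r₀) := by
    have h1 : -(η * |r - r₀|) ≤ η * (r - r₀) := by
      rw [← mul_neg]; exact mul_le_mul_of_nonneg_left (neg_abs_le _) hη0.le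
    linarith
  obtain ⟨m₂, hm₂⟩ := WithTop.exists_real_lt (G (r + η * (r - r₀)))
  have h1η : (1 + η) ≠ 0 := by positivity
  rw [← top_le_iff]
  refine WithTop.le_of_forall_real_le fun m _ => ?_
  have h := hG r₀ hr₀ _ hr₂ (η / (1 + η)) (1 / (1 + η)) (by positivity) (by positivity)
    (by field_simp; ring) ((m * (1 + η) - m₂) / η) m₂ (by rw [h0]; exact le_top) hm₂.le
  have e1 : η / (1 + η) * ((m * (1 + η) - m₂) / η) + 1 / (1 + η) * m₂ = m := by
    field_simp; ring
  have e2 : η / (1 + η) * r₀ + 1 / (1 + η) * (r + η * (r - r₀)) = r := by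
    field_simp; ring
  rwa [e1, e2] at h

/-- Either `G` is identically `∞` on the interval, or it is a real concave function on an open
interval. -/
lemma IsConcaveBeyond.continuousOn {t : ℝ} {G : ℝ → WithTop ℝ} (hG : IsConcaveBeyond t G) :
    ContinuousOn G (Set.Ioi t) := by
  by_cases h : ∃ r₀ > t, G r₀ = ⊤
  · obtain ⟨r₀, hr₀, h0⟩ := h
    exact continuousOn_const.congr fun r hr => hG.eq_top hr₀ h0 hr
  · push Not at h
    have hval : ∀ r > t, (((G r).untopD 0 : ℝ) : WithTop ℝ) = G r := fun r hr => by
      obtain ⟨s, hs⟩ := WithTop.ne_top_iff_exists.1 (h r hr)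
      rw [← hs]; rfl
    have hconc : ConcaveOn ℝ (Set.Ioi t) fun r => (G r).untopD 0 := by
      refine ⟨convex_Ioi t, fun r₁ h₁ r₂ h₂ α β hα hβ hαβ => ?_⟩
      have := hG r₁ h₁ r₂ h₂ α β hα hβ hαβ _ _ (hval r₁ h₁).le (hval r₂ h₂).le
      rw [← hval _ (combination_gt h₁ h₂ hα hβ hαβ)] at this
      simpa using WithTop.coe_le_coe.1 this
    refine ContinuousOn.congr (f := fun r => (((G r).untopD 0 : ℝ) : WithTop ℝ)) ?_
      fun r hr => (hval r hr).symm
    exact WithTop.isOpenEmbedding_coe.continuous.comp_continuousOn (hconc.continuousOn isOpen_Ioi)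

/-- A Gauss valuation is a minimum of affine functions of the logarithmic radius `r`. -/
lemma isConcaveBeyond_gaussPoint {K : Type*} [Field K] (ν : AddValuation K (WithTop ℝ)) {d : ℕ}
    (p : Fin d → ℝ) (t : ℝ) (P : MvPolynomial (Fin d) K) :
    IsConcaveBeyond t fun r => (gaussPoint ν fun i => p i + r).val P := by
  intro r₁ _ r₂ _ α β hα hβ hαβ m₁ m₂ hm₁ hm₂
  simp only [gaussPoint_val, le_gaussValue_iff] at *
  intro I
  have h1 := hm₁ I
  have h2 := hm₂ I
  by_cases htop : ν (P.coeff I) = ⊤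
  · rw [htop, WithTop.top_add]; exact le_top
  · obtain ⟨c, hc⟩ := WithTop.ne_top_iff_exists.1 htop
    rw [← hc, ← WithTop.coe_add] at h1 h2 ⊢
    rw [WithTop.coe_le_coe]
    have h3 : ∑ i, (I i : ℝ) * (p i + (α * r₁ + β * r₂)) =
        α * ∑ i, I i * (p i + r₁) + β * ∑ i, I i * (p i + r₂) := by
      rw [Finset.mul_sum, Finset.mul_sum, ← Finset.sum_add_distrib]
      refine Finset.sum_congr rfl fun i _ => ?_
      linear_combination (-(I i : ℝ) * p i) * hαβ
    rw [h3]
    have h4 := mul_le_mul_of_nonneg_left (WithTop.coe_le_coe.1 h1) hα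
    have h5 := mul_le_mul_of_nonneg_left (WithTop.coe_le_coe.1 h2) hβ
    have h6 : α * c + β * c = c := by rw [← add_mul, hαβ, one_mul]
    linarith

end Concavity

/-! ### Avoiding cancellation through the residue field. -/

section ResidueField

variable {K : Type*} [Field K] (ν : AddValuation K (WithTop ℝ))

lemma mem_valuationSubring_iff (x : K) : x ∈ ν.toValuation.valuationSubring ↔ 0 ≤ ν x := by
  rw [Valuation.mem_valuationSubring_iff]
  exact Iff.rfl

lemma residue_ne_zero_iff (x : ν.toValuation.valuationSubring) :
    IsLocalRing.residue ν.toValuation.valuationSubring x ≠ 0 ↔ ν (x : K) = 0 := by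
  rw [IsLocalRing.residue_ne_zero_iff_isUnit]
  have h0 : 0 ≤ ν (x : K) := (mem_valuationSubring_iff ν _).1 x.2
  constructor
  · rintro ⟨u, rfl⟩
    have h1 : 0 ≤ ν ((u⁻¹ : (ν.toValuation.valuationSubring)ˣ) : K) :=
      (mem_valuationSubring_iff ν _).1 (Subtype.prop _)
    have h2 := congrArg (fun y : ν.toValuation.valuationSubring => ν (y : K)) u.mul_inv
    simp only [MulMemClass.coe_mul, OneMemClass.coe_one, ν.map_mul, ν.map_one] at h2
    refine le_antisymm ?_ h0
    rw [← h2]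
    exact le_add_of_nonneg_right h1
  · intro h
    have hx : (x : K) ≠ 0 := fun hx => by simp [hx] at h
    have hinv : (x : K)⁻¹ ∈ ν.toValuation.valuationSubring := by
      rw [mem_valuationSubring_iff]
      have h2 := ν.map_mul (x : K) (x : K)⁻¹
      rw [mul_inv_cancel₀ hx, ν.map_one, h, zero_add] at h2
      exact h2.le
    exact IsUnit.of_mul_eq_one ⟨(x : K)⁻¹, hinv⟩ (Subtype.ext (mul_inv_cancel₀ hx))

/-- The value at `c` of the tropicalization of `Q` is at most the valuation of the value of `Q` at
a point whose coordinates have larger valuations. -/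
lemma NoCancellation.val_eval_le {σ : Type*} {Q : MvPolynomial σ K} {c c' : σ → K}
    (h : NoCancellation ν Q c) (hc : ∀ s, ν (c s) ≤ ν (c' s)) :
    ν (MvPolynomial.eval c Q) ≤ ν (MvPolynomial.eval c' Q) := by
  classical
  rw [h, MvPolynomial.eval_eq]
  refine ν.map_le_sum fun m hm => (Finset.inf_le hm).trans ?_
  rw [ν.map_mul]
  refine add_le_add_right ?_ _
  have hprod : ∀ S : Finset σ, ν (∏ s ∈ S, c' s ^ m s) = ∑ s ∈ S, m s • ν (c' s) := by
    intro S
    induction S using Finset.induction_on with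
    | empty => simp
    | insert i S hi ih => rw [Finset.prod_insert hi, Finset.sum_insert hi, ν.map_mul, ν.map_pow, ih]
  rw [hprod]
  exact Finset.sum_le_sum fun s _ => nsmul_le_nsmul_right (hc s) _

/-- The reduction of a nonzero polynomial `Q` at a point `a` detects cancellations in the values of
`Q` at the points `a u` with units `u`. -/
lemma exists_reduction {σ : Type*} {Q : MvPolynomial σ K} (hQ : Q ≠ 0) {a : σ → K}
    (ha : ∀ s, a s ≠ 0) :
    ∃ R : MvPolynomial σ (IsLocalRing.ResidueField ν.toValuation.valuationSubring), R ≠ 0 ∧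
      ∀ u : σ → ν.toValuation.valuationSubring, (∀ s, ν (u s : K) = 0) →
        MvPolynomial.eval (fun s => IsLocalRing.residue _ (u s)) R ≠ 0 →
          NoCancellation ν Q fun s => a s * u s := by
  classical
  set O := ν.toValuation.valuationSubring
  let T : (σ →₀ ℕ) → K := fun m => Q.coeff m * m.prod fun s n => a s ^ n
  have hT : ∀ m, ν (T m) = ν (Q.coeff m) + m.sum fun s n => n • ν (a s) := by
    intro m
    have hprod : ∀ S : Finset σ, ν (∏ s ∈ S, a s ^ m s) = ∑ s ∈ S, m s • ν (a s) := by
      intro S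
      induction S using Finset.induction_on with
      | empty => simp
      | insert i S hi ih =>
        rw [Finset.prod_insert hi, Finset.sum_insert hi, ν.map_mul, ν.map_pow, ih]
    rw [ν.map_mul]
    exact congrArg _ (hprod _)
  -- Dividing by a lowest term makes all coefficients integral and one of them `1`, so the reduction
  -- is nonzero.
  obtain ⟨m₀, hm₀, hmin⟩ := Q.support.exists_min_image (fun m => ν (T m))
    (MvPolynomial.support_nonempty.2 hQ)
  have hb : T m₀ ≠ 0 := mul_ne_zero (MvPolynomial.mem_support_iff.1 hm₀)
    (Finset.prod_ne_zero_iff.2 fun s _ => pow_ne_zero _ (ha s))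
  have hbt : ν (T m₀) ≠ ⊤ := ν.ne_top_iff.2 hb
  have hmem : ∀ m ∈ Q.support, T m / T m₀ ∈ O := by
    intro m hm
    rw [mem_valuationSubring_iff]
    have h1 : ν (T m / T m₀) + ν (T m₀) = ν (T m) := by rw [← ν.map_mul, div_mul_cancel₀ _ hb]
    have h2 := hmin m hm
    rw [← h1] at h2
    exact (WithTop.add_le_add_iff_right hbt).1 (by simpa using h2)
  let e : (σ →₀ ℕ) → O := fun m => if h : m ∈ Q.support then ⟨T m / T m₀, hmem m h⟩ else 0
  have he : ∀ m ∈ Q.support, (e m : K) = T m / T m₀ := fun m hm => by simp only [e, dif_pos hm]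
  let N : MvPolynomial σ O := ∑ m ∈ Q.support, MvPolynomial.monomial m (e m)
  have hinf : (Q.support.inf fun m => ν (Q.coeff m) + m.sum fun s n => n • ν (a s)) = ν (T m₀) := by
    refine le_antisymm ((Finset.inf_le hm₀).trans_eq (hT m₀).symm) (Finset.le_inf fun m hm => ?_)
    rw [← hT]
    exact hmin m hm
  refine ⟨MvPolynomial.map (IsLocalRing.residue O) N, fun h0 => ?_, fun u hu hR => ?_⟩
  · have h1 := congrArg (MvPolynomial.coeff m₀) h0
    rw [MvPolynomial.coeff_map, MvPolynomial.coeff_sum, Finset.sum_eq_single m₀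
      (fun m _ hne => by rw [MvPolynomial.coeff_monomial, if_neg hne])
      (fun h => absurd hm₀ h), MvPolynomial.coeff_monomial, if_pos rfl] at h1
    have h2 : e m₀ = 1 := Subtype.ext (by rw [he m₀ hm₀, div_self hb]; rfl)
    rw [h2, map_one, MvPolynomial.coeff_zero] at h1
    exact one_ne_zero h1
  · have h1 : MvPolynomial.eval (fun s => IsLocalRing.residue O (u s))
        (MvPolynomial.map (IsLocalRing.residue O) N) =
        IsLocalRing.residue O (MvPolynomial.eval u N) := by
      rw [MvPolynomial.eval_map]
      exact (MvPolynomial.eval₂_comp_left (IsLocalRing.residue O) (RingHom.id O) u N).symm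
    rw [h1, residue_ne_zero_iff] at hR
    have h2 : MvPolynomial.eval (fun s => a s * u s) Q = T m₀ * (MvPolynomial.eval u N : O) := by
      rw [MvPolynomial.eval_eq, map_sum, AddSubmonoidClass.coe_finsetSum, Finset.mul_sum]
      refine Finset.sum_congr rfl fun m hm => ?_
      rw [MvPolynomial.eval_monomial, MulMemClass.coe_mul, he m hm, ← mul_assoc,
        mul_div_cancel₀ _ hb]
      simp only [T, Finsupp.prod, mul_pow, Finset.prod_mul_distrib, mul_assoc]
      congr 2
      rw [SubmonoidClass.coe_finsetProd]
      simp
    have h3 : ∀ s, ν (a s * u s) = ν (a s) := fun s => by rw [ν.map_mul, hu, add_zero]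
    rw [NoCancellation, h2, ν.map_mul, hR, add_zero]
    simp only [h3]
    exact hinf.symm

lemma exists_unit_lift_eval_ne_zero [Infinite (IsLocalRing.ResidueField ν.toValuation.valuationSubring)]
    {σ : Type*} {R : MvPolynomial σ (IsLocalRing.ResidueField ν.toValuation.valuationSubring)}
    (hR : R ≠ 0) : ∃ u : σ → ν.toValuation.valuationSubring, (∀ s, ν (u s : K) = 0) ∧
      MvPolynomial.eval (fun s => IsLocalRing.residue _ (u s)) R ≠ 0 := by
  classical
  -- The factor formed by the variables forces nonzero coordinates, so that they lift to units.
  have hR' : R * ∏ s ∈ R.vars, MvPolynomial.X s ≠ 0 :=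
    mul_ne_zero hR (Finset.prod_ne_zero_iff.2 fun s _ => MvPolynomial.X_ne_zero s)
  obtain ⟨y, hy⟩ : ∃ y, MvPolynomial.eval y (R * ∏ s ∈ R.vars, MvPolynomial.X s) ≠ 0 := by
    by_contra! h
    exact hR' (MvPolynomial.funext fun y => by rw [h y, map_zero])
  rw [map_mul, map_prod] at hy
  have hy1 := left_ne_zero_of_mul hy
  have hy2 : ∀ s ∈ R.vars, y s ≠ 0 := fun s hs => by
    have := Finset.prod_ne_zero_iff.1 (right_ne_zero_of_mul hy) s hs
    rwa [MvPolynomial.eval_X] at this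
  let y' : σ → IsLocalRing.ResidueField ν.toValuation.valuationSubring := fun s =>
    if s ∈ R.vars then y s else 1
  have hy' : ∀ s, y' s ≠ 0 := fun s => by
    simp only [y']
    split_ifs with h
    · exact hy2 s h
    · exact one_ne_zero
  choose u hu using fun s => IsLocalRing.residue_surjective (y' s)
  refine ⟨u, fun s => (residue_ne_zero_iff ν _).1 (by rw [hu]; exact hy' s), ?_⟩
  simp only [hu]
  have : MvPolynomial.eval y' R = MvPolynomial.eval y R :=
    MvPolynomial.eval₂Hom_congr' rfl (fun s hs _ => if_pos hs) rfl
  rw [this]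
  exact hy1

/-- Both conditions are nonvanishing of a reduction at the residues of the units, so the product of
the two reductions handles them at once. -/
lemma exists_noCancellation_two
    [Infinite (IsLocalRing.ResidueField ν.toValuation.valuationSubring)] {σ : Type*}
    {φ : σ → WithTop ℝ} (hφ : ∀ s, φ s ≠ ⊤) (hr : ∀ s, φ s ∈ Set.range ν)
    {Q₁ Q₂ : MvPolynomial σ K} (h₁ : Q₁ ≠ 0) (h₂ : Q₂ ≠ 0) :
    ∃ c : σ → K, (∀ s, ν (c s) = φ s) ∧ NoCancellation ν Q₁ c ∧ NoCancellation ν Q₂ c := by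
  choose a ha using hr
  have ha0 : ∀ s, a s ≠ 0 := fun s => ν.ne_top_iff.1 (by rw [ha]; exact hφ s)
  obtain ⟨R₁, hR₁, hu₁⟩ := exists_reduction ν h₁ ha0
  obtain ⟨R₂, hR₂, hu₂⟩ := exists_reduction ν h₂ ha0
  obtain ⟨u, hu, hev⟩ := exists_unit_lift_eval_ne_zero ν (mul_ne_zero hR₁ hR₂)
  rw [map_mul] at hev
  exact ⟨fun s => a s * u s, fun s => by rw [ν.map_mul, hu, add_zero, ha],
    hu₁ u hu (left_ne_zero_of_mul hev), hu₂ u hu (right_ne_zero_of_mul hev)⟩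

end ResidueField

/-! ### Matrices supported on cycles. -/

section PartialPermutationMatrix

/-- The characteristic polynomial of a matrix supported on the cycles of a permutation. -/
lemma val_charpoly_coeff_partialPerm {K : Type*} [Field K] (ν : AddValuation K (WithTop ℝ)) {d : ℕ}
    {τ : Equiv.Perm (Fin d)} {T : Finset (Fin d)} (hT : ∀ i ∉ T, τ i = i) (s : Fin d → K) :
    ν ((Matrix.of fun i j => if j ∈ T ∧ i = τ j then s j else 0 :
      Matrix (Fin d) (Fin d) K).charpoly.coeff (d - T.card)) = ∑ j ∈ T, ν (s j) := by
  classical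
  set A : Matrix (Fin d) (Fin d) K := Matrix.of fun i j => if j ∈ T ∧ i = τ j then s j else 0 with hA
  -- Columns outside `T` of the characteristic matrix are `X` times unit vectors. Pulling out these
  -- factors leaves a matrix whose value at `X = 0` is a weighted permutation matrix.
  let N : Matrix (Fin d) (Fin d) (Polynomial K) :=
    Matrix.of fun i j => if j ∈ T then A.charmatrix i j else if i = j then 1 else 0
  let D : Fin d → Polynomial K := fun j => if j ∈ T then 1 else Polynomial.X
  have hfac : A.charmatrix = N * Matrix.diagonal D := by
    ext1 i j
    rw [Matrix.mul_diagonal]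
    simp only [N, D, Matrix.of_apply]
    by_cases hj : j ∈ T
    · simp [hj]
    · by_cases hij : i = j
      · subst hij
        simp [hj, hA]
      · simp [hj, hA, hij]
  have hD : ∏ j, D j = Polynomial.X ^ (d - T.card) := by
    simp only [D]
    rw [Finset.prod_ite, Finset.prod_const_one, one_mul, Finset.prod_const]
    congr 1
    have h := Finset.card_compl T
    rw [Fintype.card_fin] at h
    rw [← h]
    congr 1
    ext i
    simp
  let s' : Fin d → K := fun j => if j ∈ T then -s j else 1
  have hN : ∀ i j, (N i j).coeff 0 = if i = τ j then s' j else 0 := by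
    intro i j
    simp only [N, Matrix.of_apply, s']
    by_cases hj : j ∈ T
    · rw [if_pos hj, if_pos hj, Matrix.charmatrix_apply, Polynomial.coeff_sub, Polynomial.coeff_C_zero]
      have : (Matrix.diagonal (fun _ : Fin d => (Polynomial.X : Polynomial K)) i j).coeff 0 = 0 := by
        rw [Matrix.diagonal_apply]; split_ifs <;> simp
      rw [this, hA]
      by_cases hi : i = τ j <;> simp [hj, hi]
    · rw [if_neg hj, if_neg hj, hT j hj]
      split_ifs <;> simp
  have hcoeff : A.charpoly.coeff (d - T.card) = (N.det).coeff 0 := by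
    rw [Matrix.charpoly, hfac, Matrix.det_mul, Matrix.det_diagonal, hD]
    simpa using Polynomial.coeff_mul_X_pow N.det (d - T.card) 0
  have hdet : (N.det).coeff 0 = ((Equiv.Perm.sign τ : ℤ) : K) * ∏ j, s' j := by
    have h1 : (N.det).coeff 0 = (Matrix.of fun i j => if i = τ j then s' j else 0 :
        Matrix (Fin d) (Fin d) K).det := by
      rw [Polynomial.coeff_zero_eq_eval_zero, ← Polynomial.coe_evalRingHom, RingHom.map_det]
      congr 1
      ext1 i j
      rw [RingHom.mapMatrix_apply, Matrix.map_apply, Polynomial.coe_evalRingHom,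
        ← Polynomial.coeff_zero_eq_eval_zero, hN]
      rfl
    rw [h1, Matrix.det_apply', Finset.sum_eq_single τ]
    · simp
    · intro σ _ hσ
      obtain ⟨i, hi⟩ : ∃ i, σ i ≠ τ i := by
        by_contra! h
        exact hσ (Equiv.ext h)
      rw [Finset.prod_eq_zero (Finset.mem_univ i) (by simp [hi]), mul_zero]
    · simp
  have hsign : ν ((Equiv.Perm.sign τ : ℤ) : K) = 0 := by
    rcases Int.units_eq_one_or (Equiv.Perm.sign τ) with h | h <;> rw [h] <;> simp [ν.map_neg]
  have hprod : ∀ S : Finset (Fin d), ν (∏ j ∈ S, s' j) = ∑ j ∈ S, ν (s' j) := by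
    intro S
    induction S using Finset.induction_on with
    | empty => simp
    | insert i S hi ih => rw [Finset.prod_insert hi, Finset.sum_insert hi, ν.map_mul, ih]
  rw [hcoeff, hdet, ν.map_mul, hsign, zero_add, hprod]
  rw [← Finset.sum_subset (Finset.subset_univ T) (fun j _ hj => by simp [s', hj])]
  exact Finset.sum_congr rfl fun j hj => by simp [s', hj, ν.map_neg]

end PartialPermutationMatrix

/-! ### Construction of generic lifts. -/

section GenericLifts

variable {K : Type*} [Field K] {ν : AddValuation K (WithTop ℝ)} {d : ℕ}

/-- Lifts of `f` exist that avoid a given cancellation and for which a coefficient of the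
characteristic polynomial of the linear part is as large as the cycles of `f` allow. -/
lemma exists_generic_lift [Infinite (IsLocalRing.ResidueField ν.toValuation.valuationSubring)]
    {f : Fin d → TropSeries d} (hf : IsConvergentTropGerm f) (hval : ∀ i I, f i I ∈ Set.range ν)
    {Q : MvPolynomial (TropSupport f) K} (hQ : Q ≠ 0) {τ : Equiv.Perm (Fin d)} {T : Finset (Fin d)}
    (hT : ∀ i ∉ T, τ i = i) (hW : cycleWeight (tropLinearPart f) τ T ≠ ⊤) :
    ∃ F, IsLift ν f F ∧
      NoCancellation ν Q (fun s => MvPowerSeries.coeff s.1.2 (F s.1.1)) ∧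
      ν ((linearPart F).charpoly.coeff (d - T.card)) ≤ cycleWeight (tropLinearPart f) τ T := by
  classical
  -- The linear part of the universal lift, with independent variables as its nonzero entries.
  let M : Matrix (Fin d) (Fin d) (MvPolynomial (TropSupport f) K) := Matrix.of fun i j =>
    if h : f i (Finsupp.single j 1) ≠ ⊤ then MvPolynomial.X ⟨(i, Finsupp.single j 1), h⟩ else 0
  set E := M.charpoly.coeff (d - T.card) with hE
  have hEeval : ∀ c : TropSupport f → K, MvPolynomial.eval c E =
      (Matrix.of fun i j => if h : f i (Finsupp.single j 1) ≠ ⊤ then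
        c ⟨(i, Finsupp.single j 1), h⟩ else 0 : Matrix (Fin d) (Fin d) K).charpoly.coeff
          (d - T.card) := by
    intro c
    have h1 := Matrix.charpoly_map M (MvPolynomial.eval c)
    have h2 : M.map (MvPolynomial.eval c) = Matrix.of fun i j =>
        if h : f i (Finsupp.single j 1) ≠ ⊤ then c ⟨(i, Finsupp.single j 1), h⟩ else 0 := by
      ext1 i j
      simp only [M, Matrix.map_apply, Matrix.of_apply]
      split_ifs <;> simp
    rw [← h2, h1, Polynomial.coeff_map]
  have hfin : ∀ i ∈ T, f (τ i) (Finsupp.single i 1) ≠ ⊤ := fun i hi h =>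
    hW (WithTop.sum_eq_top.2 ⟨i, hi, h⟩)
  -- Setting the variables off the cycles of `τ` on `T` to zero isolates one term of `E`. Without
  -- cancellation at `c`, its valuation bounds that of `E` at `c`; it also shows that `E` is
  -- nonzero.
  have hspec : ∀ c : TropSupport f → K, (∀ s, ν (c s) = f s.1.1 s.1.2) →
      ∃ c' : TropSupport f → K, (∀ s, ν (c s) ≤ ν (c' s)) ∧
        ν (MvPolynomial.eval c' E) = cycleWeight (tropLinearPart f) τ T := by
    intro c hc
    refine ⟨fun s => if ∃ j ∈ T, s.1 = (τ j, Finsupp.single j 1) then c s else 0, fun s => ?_, ?_⟩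
    · dsimp only
      split_ifs
      · exact le_rfl
      · rw [ν.map_zero]; exact le_top
    · let s : Fin d → K := fun j => if h : f (τ j) (Finsupp.single j 1) ≠ ⊤ then
        c ⟨(τ j, Finsupp.single j 1), h⟩ else 0
      have h1 := val_charpoly_coeff_partialPerm ν hT s
      have h2 : ∀ j, ν (s j) = tropLinearPart f (τ j) j := by
        intro j
        simp only [s]
        split_ifs with h
        · exact hc _
        · rw [ν.map_zero]; exact (not_not.1 h).symm
      rw [hEeval]
      simp only [h2] at h1
      refine Eq.trans (congrArg (fun A : Matrix (Fin d) (Fin d) K =>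
        ν (A.charpoly.coeff (d - T.card))) ?_) h1
      ext1 i j
      simp only [Matrix.of_apply]
      have h3 : (∃ l ∈ T, (i, Finsupp.single j 1) = (τ l, (Finsupp.single l 1 : Fin d →₀ ℕ))) ↔
          j ∈ T ∧ i = τ j := by
        constructor
        · rintro ⟨l, hl, heq⟩
          obtain ⟨rfl, h⟩ := Prod.mk.inj heq
          have hjl : j = l := Finsupp.single_left_injective one_ne_zero h
          exact ⟨hjl ▸ hl, by rw [hjl]⟩
        · rintro ⟨hj, rfl⟩
          exact ⟨j, hj, rfl⟩
      by_cases h4 : j ∈ T ∧ i = τ j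
      · obtain ⟨hj, rfl⟩ := h4
        rw [dif_pos (hfin j hj), if_pos (h3.2 ⟨hj, rfl⟩), if_pos ⟨hj, rfl⟩]
        simp only [s]
        rw [dif_pos (hfin j hj)]
      · rw [if_neg h4]
        split_ifs with h5 h6
        · exact absurd (h3.1 h6) h4
        · rfl
        · rfl
  have hE0 : E ≠ 0 := by
    intro h0
    choose a ha using fun s : TropSupport f => hval s.1.1 s.1.2
    obtain ⟨c', -, hc'⟩ := hspec a ha
    rw [h0, map_zero, ν.map_zero] at hc'
    exact hW hc'.symm
  obtain ⟨c, hc, hcQ, hcE⟩ := exists_noCancellation_two ν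
    (φ := fun s : TropSupport f => f s.1.1 s.1.2) (fun s => s.2) (fun s => hval _ _) hQ hE0
  obtain ⟨c', hcc', hc'⟩ := hspec c hc
  let F : Fin d → MvPowerSeries (Fin d) K := fun i I => if h : f i I ≠ ⊤ then c ⟨(i, I), h⟩ else 0
  have hFc : ∀ i I, MvPowerSeries.coeff I (F i) = if h : f i I ≠ ⊤ then c ⟨(i, I), h⟩ else 0 :=
    fun _ _ => rfl
  have hFν : ∀ i I, ν (MvPowerSeries.coeff I (F i)) = f i I := by
    intro i I
    rw [hFc]
    split_ifs with h
    · exact hc _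
    · rw [ν.map_zero]; exact (not_not.1 h).symm
  refine ⟨F, fun i => ⟨?_, hFν i⟩, ?_, ?_⟩
  · obtain ⟨a, b, -, hab⟩ := hf.coeff_ge
    refine ⟨a + 1, WithTop.tendsto_nhds_top_real.2 fun m => ?_⟩
    obtain ⟨n, hn⟩ := exists_nat_ge (m - b)
    rw [eventually_cofinite]
    refine (Finsupp.finite_of_degree_lt (σ := Fin d) n).subset fun I hI => ?_
    by_contra hcon
    refine hI (le_trans ?_ (add_le_add_left ((hab i I).trans_eq (hFν i I).symm) _))
    rw [← WithTop.coe_add]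
    have h1 : (n : ℝ) ≤ I.degree := by exact_mod_cast not_lt.1 hcon
    exact_mod_cast (by linarith : m ≤ b - a * I.degree + (a + 1) * I.degree)
  · refine Eq.mp (congrArg (NoCancellation ν Q) (funext fun s => ?_)) hcQ
    rw [hFc, dif_pos s.2]
  · rw [← hc']
    refine Eq.trans_le ?_ (hcE.val_eval_le ν hcc')
    rw [hEeval]
    rfl

end GenericLifts

/-! ### Lifts that are not contracting. -/

section Noncontracting

variable {K : Type*} [Field K] {ν : AddValuation K (WithTop ℝ)} {d : ℕ}

lemma exists_pow_entry_lt (A : Matrix (Fin d) (Fin d) K) {k : ℕ} (hk : k ≤ d) {n : ℕ} (hn : 0 < n)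
    {μ : ℝ} (h : ν (A.charpoly.coeff (d - k)) < ((k * μ : ℝ) : WithTop ℝ)) :
    ∃ i j, ν ((A ^ n) i j) < ((n * μ : ℝ) : WithTop ℝ) := by
  by_contra! hcon
  have h1 := le_val_charpoly_coeff ν A hn hcon (d - k)
  obtain ⟨s, hs⟩ := WithTop.ne_top_iff_exists.1 h.ne_top
  rw [← hs] at h h1
  rw [← WithTop.coe_add] at h1
  have h2 := WithTop.coe_le_coe.1 h1
  have h3 := WithTop.coe_lt_coe.1 h
  rw [Nat.cast_sub hk] at h2
  linarith

lemma IsLift.coeff_zero {f : Fin d → TropSeries d} (hf : IsConvergentTropGerm f)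
    {F : Fin d → MvPowerSeries (Fin d) K} (hF : IsLift ν f F) (i : Fin d) :
    MvPowerSeries.coeff 0 (F i) = 0 := by
  rw [← ν.top_iff, (hF i).2, (hf i).2]

/-- An attracted neighbourhood inside the open unit polydisc is stable, so it contains the whole
orbit of a Gauss point. But entries of the powers of the linear part grow exponentially, which
pushes a coordinate of the orbit out of the unit polydisc. -/
lemma not_isContracting_of_charpoly_neg {F : Fin d → MvPowerSeries (Fin d) K}
    (hF0 : ∀ i, MvPowerSeries.coeff 0 (F i) = 0) {k : ℕ} (hk0 : 0 < k) (hk : k ≤ d)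
    (hχ : ν ((linearPart F).charpoly.coeff (d - k)) < 0) : ¬ IsContractingAnalyticGerm ν F := by
  intro hcon
  obtain ⟨V, hVU, hVo, hV0, hVd, -, hCV⟩ := hcon _
    ((BerkovichAffine.isOpen_polydisc (ν := ν) fun _ : Fin d => 0).mem_nhds
      (BerkovichAffine.origin_mem_polydisc _))
  obtain ⟨t, ht⟩ := BerkovichAffine.exists_polydisc_subset (hVo.mem_nhds hV0)
  have hstep : ∀ w : V, ∃ w' : V, BerkovichAffine.MapsTo F w.1 w'.1 := fun w => by
    obtain ⟨y, hy⟩ := hVd w w.2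
    exact ⟨⟨y, hCV (subset_closure ⟨w, w.2, hy⟩)⟩, hy⟩
  choose φ hφ using hstep
  let w₀ : V := ⟨gaussPoint ν fun _ => t, ht _ fun i => le_gaussPoint_val_X ν (fun _ => t) i⟩
  let z : ℕ → V := fun n => φ^[n] w₀
  have hz : ∀ n, BerkovichAffine.MapsTo F (z n).1 (z (n + 1)).1 := fun n => by
    simp only [z, Function.iterate_succ_apply']
    exact hφ _
  obtain ⟨s, hs⟩ := WithTop.ne_top_iff_exists.1 hχ.ne_top
  rw [← hs] at hχ
  have hs0 : s < 0 := by exact_mod_cast hχ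
  have hkpos : (0 : ℝ) < k := by exact_mod_cast hk0
  -- Half of the slope `s / k`: still negative, and it satisfies the strict inequality `s < k * μ`.
  set μ := s / (2 * k) with hμ
  have hμ0 : μ < 0 := div_neg_of_neg_of_pos hs0 (by positivity)
  have hkμ : s < k * μ := by
    have : k * μ = s / 2 := by rw [hμ]; field_simp
    linarith
  obtain ⟨n, hn⟩ := exists_nat_gt (t / -μ)
  have hn1 : t + (n + 1 : ℕ) * μ < 0 := by
    rw [div_lt_iff₀ (by linarith)] at hn
    push_cast
    linarith
  obtain ⟨i, j, hij⟩ := exists_pow_entry_lt (linearPart F) hk (Nat.succ_pos n) (μ := μ)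
    (by rw [← hs]; exact_mod_cast hkμ)
  have h1 := val_X_iterate_le hF0 (z := fun n => (z n).1) rfl hz (n + 1) i j
  have h2 := hVU (z (n + 1)).2 i
  have h3 := h2.trans_le (h1.trans (add_le_add_left hij.le _))
  rw [← WithTop.coe_add] at h3
  have h4 := WithTop.coe_lt_coe.1 h3
  push_cast at h4 hn1
  linarith

lemma IsConcaveBeyond.congr {t : ℝ} {g G : ℝ → WithTop ℝ} (hg : IsConcaveBeyond t g)
    (h : ∀ r > t, G r = g r) : IsConcaveBeyond t G := by
  intro r₁ h₁ r₂ h₂ α β hα hβ hαβ m₁ m₂ hm₁ hm₂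
  rw [h _ (combination_gt h₁ h₂ hα hβ hαβ)]
  rw [h _ h₁] at hm₁
  rw [h _ h₂] at hm₂
  exact hg r₁ h₁ r₂ h₂ α β hα hβ hαβ m₁ m₂ hm₁ hm₂

/-- The Gauss points of a family of polydiscs that are stable under `F` accumulate under iteration
at a continuous family of points, which cannot leave an attracted neighbourhood of the origin. -/
lemma not_isContracting_of_charpoly_nonpos {F : Fin d → MvPowerSeries (Fin d) K}
    (hF0 : ∀ i, MvPowerSeries.coeff 0 (F i) = 0) {k : ℕ} (hk0 : 0 < k) (hk : k ≤ d)
    (hχ : ν ((linearPart F).charpoly.coeff (d - k)) ≤ 0) {p : Fin d → ℝ} {t : ℝ}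
    (hstable : ∀ r > t, ∀ w : BerkovichAffine ν d,
      (∀ i, ((p i + r : ℝ) : WithTop ℝ) ≤ w.val (MvPolynomial.X i)) →
      ∃ w', BerkovichAffine.MapsTo F w w' ∧
        ∀ i, ((p i + r : ℝ) : WithTop ℝ) ≤ w'.val (MvPolynomial.X i)) :
    ¬ IsContractingAnalyticGerm ν F := by
  intro hcon
  -- Orbits of Gauss points, chosen for all real `r`; the values for `r ≤ t` are placeholders.
  have hseq : ∀ r, ∃ z : ℕ → BerkovichAffine ν d, r > t →
      z 0 = (gaussPoint ν fun i => p i + r) ∧ (∀ n, BerkovichAffine.MapsTo F (z n) (z (n + 1))) ∧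
      ∀ n i, ((p i + r : ℝ) : WithTop ℝ) ≤ (z n).val (MvPolynomial.X i) := by
    intro r
    by_cases hr : r > t
    · choose φ hφ using fun w : {w : BerkovichAffine ν d //
        ∀ i, ((p i + r : ℝ) : WithTop ℝ) ≤ w.val (MvPolynomial.X i)} => hstable r hr w.1 w.2
      let z : ℕ → {w : BerkovichAffine ν d //
        ∀ i, ((p i + r : ℝ) : WithTop ℝ) ≤ w.val (MvPolynomial.X i)} := fun n =>
        (fun w => ⟨φ w, (hφ w).2⟩)^[n]
          ⟨gaussPoint ν fun i => p i + r, le_gaussPoint_val_X ν fun i => p i + r⟩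
      refine ⟨fun n => (z n).1, fun _ => ⟨rfl, fun n => ?_, fun n => (z n).2⟩⟩
      simp only [z, Function.iterate_succ_apply']
      exact (hφ _).1
    · exact ⟨fun _ => BerkovichAffine.origin ν d, fun h => absurd h hr⟩
  choose z hz using hseq
  have hlim : ∀ r, ∃ y : BerkovichAffine ν d, r > t →
      (∀ i, ((p i + r : ℝ) : WithTop ℝ) ≤ y.val (MvPolynomial.X i)) ∧
      Tendsto (z r) (hyperfilter ℕ) (𝓝 y) := by
    intro r
    by_cases hr : r > t
    · obtain ⟨y, hy, hle⟩ := isCompact_iff_ultrafilter_le_nhds.1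
        (BerkovichAffine.isCompact_polydisc (ν := ν) fun i => p i + r)
        ((hyperfilter ℕ).map (z r))
        (le_principal_iff.2 (Ultrafilter.mem_map.2 (Eventually.of_forall (hz r hr).2.2)))
      exact ⟨y, fun _ => ⟨hy, hle⟩⟩
    · exact ⟨BerkovichAffine.origin ν d, fun h => absurd h hr⟩
  choose y hy using hlim
  -- The value of an image on `P` is a limit of values on truncations of `P ∘ F`. Hence concavity in
  -- `r` is inherited along the orbit and by its limit `y r`.
  have hconc : ∀ n P, IsConcaveBeyond t fun r => (z r n).val P := by
    intro n
    induction n with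
    | zero =>
      exact fun P => (isConcaveBeyond_gaussPoint ν p t P).congr fun r hr => by rw [(hz r hr).1]
    | succ n ih =>
      exact fun P => IsConcaveBeyond.of_tendsto
        (fun S => ih (seriesTrunc (MvPolynomial.aeval F P) S)) fun r hr => (hz r hr).2.1 n P
  have hyconc : ∀ P, IsConcaveBeyond t fun r => (y r).val P := fun P =>
    IsConcaveBeyond.of_tendsto (fun n => hconc n P) fun r hr =>
      BerkovichAffine.tendsto_nhds_iff.1 (hy r hr).2 P
  let Y : Set.Ioi t → BerkovichAffine ν d := fun r => y r
  have hY : Continuous Y := by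
    refine continuous_iff_continuousAt.2 fun r => BerkovichAffine.tendsto_nhds_iff.2 fun P => ?_
    exact (continuousOn_iff_continuous_domRestrict.1 (hyconc P).continuousOn).tendsto r
  set B : ℝ := ∑ i, |p i|
  have hB : ∀ i, |p i| ≤ B := fun i =>
    Finset.single_le_sum (f := fun i => |p i|) (fun i _ => abs_nonneg _) (Finset.mem_univ i)
  -- With slope `1 / n`, each power `n ≥ 1` of the linear part has an entry of valuation below `1`.
  -- So no iterate comes much closer to the origin than its starting point.
  have hupper : ∀ r > t, ∃ i, (y r).val (MvPolynomial.X i) ≤ ((1 + B + r : ℝ) : WithTop ℝ) := by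
    intro r hr
    have hcl : IsClosed {w : BerkovichAffine ν d |
        ∃ i, w.val (MvPolynomial.X i) ≤ ((1 + B + r : ℝ) : WithTop ℝ)} := by
      simp only [Set.ofPred_exists]
      exact isClosed_iUnion_of_finite fun i =>
        isClosed_le (BerkovichAffine.continuous_val _) continuous_const
    refine hcl.mem_of_tendsto (hy r hr).2 ?_
    have h1 : ∀ᶠ n in (hyperfilter ℕ : Filter ℕ), 1 ≤ n :=
      (Nat.hyperfilter_le_atTop) (eventually_ge_atTop 1)
    filter_upwards [h1] with n hn
    have hnpos : (0 : ℝ) < n := by exact_mod_cast hn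
    have hkpos : (0 : ℝ) < k := by exact_mod_cast hk0
    obtain ⟨i, j, hij⟩ := exists_pow_entry_lt (linearPart F) hk hn (μ := 1 / n)
      (lt_of_le_of_lt hχ (by exact_mod_cast (by positivity : (0 : ℝ) < k * (1 / n))))
    rw [mul_one_div_cancel hnpos.ne'] at hij
    refine ⟨i, (val_X_iterate_le hF0 (hz r hr).1 (hz r hr).2.1 n i j).trans
      ((add_le_add_left hij.le _).trans ?_)⟩
    rw [← WithTop.coe_add]
    have := (le_abs_self (p j)).trans (hB j)
    exact_mod_cast (by linarith : 1 + (p j + r) ≤ 1 + B + r)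
  obtain ⟨V, hVU, hVo, hV0, hVd, -, hCV⟩ := hcon _
    ((BerkovichAffine.isOpen_polydisc (ν := ν) fun _ : Fin d => t + 2 + B).mem_nhds
      (BerkovichAffine.origin_mem_polydisc _))
  set C := closure {y | ∃ x ∈ V, BerkovichAffine.MapsTo F x y}
  -- Once the orbit visits `V` it stays there and all later points lie in the closed set `C`, hence
  -- so does the limit. This makes the set of `r` with `y r ∈ V` closed as well as open.
  have hVC : ∀ r > t, y r ∈ V → y r ∈ C := by
    intro r hr hyV
    obtain ⟨n, hn⟩ := ((hy r hr).2.eventually (hVo.mem_nhds hyV)).exists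
    have hmem : ∀ m, n ≤ m → z r m ∈ V ∧ z r (m + 1) ∈ C := by
      intro m hm
      induction m, hm using Nat.le_induction with
      | base => exact ⟨hn, subset_closure ⟨_, hn, (hz r hr).2.1 n⟩⟩
      | succ m _ ih =>
        have h1 := hCV ih.2
        exact ⟨h1, subset_closure ⟨_, h1, (hz r hr).2.1 (m + 1)⟩⟩
    refine isClosed_closure.mem_of_tendsto (hy r hr).2 ?_
    have h1 : ∀ᶠ m in (hyperfilter ℕ : Filter ℕ), n + 1 ≤ m :=
      (Nat.hyperfilter_le_atTop) (eventually_ge_atTop (n + 1))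
    filter_upwards [h1] with m hm
    obtain ⟨m, rfl⟩ : ∃ l, m = l + 1 := ⟨m - 1, by omega⟩
    exact (hmem m (by omega)).2
  have hclopen : IsClopen (Y ⁻¹' V) := by
    refine ⟨?_, hVo.preimage hY⟩
    have : Y ⁻¹' V = Y ⁻¹' C := by
      ext r
      exact ⟨fun h => hVC r r.2 h, fun h => hCV h⟩
    rw [this]
    exact isClosed_closure.preimage hY
  have hne : (Y ⁻¹' V).Nonempty := by
    obtain ⟨s, hs⟩ := BerkovichAffine.exists_polydisc_subset (hVo.mem_nhds hV0)
    have hr : max (t + 1) (s + B) > t := lt_of_lt_of_le (by linarith) (le_max_left _ _)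
    refine ⟨⟨_, hr⟩, hs _ fun i => le_trans ?_ ((hy _ hr).1 i)⟩
    have h1 := (neg_le_abs (p i)).trans (hB i)
    have h2 := le_max_right (t + 1) (s + B)
    exact_mod_cast (by linarith : s ≤ p i + max (t + 1) (s + B))
  have : PreconnectedSpace (Set.Ioi t) := Subtype.preconnectedSpace isPreconnected_Ioi
  have huniv := hclopen.eq_univ hne
  have ht1 : t + 1 > t := by linarith
  -- At `r = t + 1` the bound of `hupper` is exactly `t + 2 + B`, whereas `V` lies strictly beyond
  -- this value.
  have hmem : (⟨t + 1, ht1⟩ : Set.Ioi t) ∈ Y ⁻¹' V := by rw [huniv]; exact Set.mem_univ _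
  obtain ⟨i, hi⟩ := hupper (t + 1) ht1
  have h1 := (hVU hmem i).trans_le hi
  have h2 := WithTop.coe_lt_coe.1 h1
  linarith

/-- If some cycle has nonpositive weight, generic lifts are not contracting. -/
lemma cycleWeight_pos_of_forGenericLifts
    [Infinite (IsLocalRing.ResidueField ν.toValuation.valuationSubring)]
    {f : Fin d → TropSeries d} (hf : IsConvergentTropGerm f) (hval : ∀ i I, f i I ∈ Set.range ν)
    (hgen : ForGenericLifts ν f (IsContractingAnalyticGerm ν)) {τ : Equiv.Perm (Fin d)}
    {T : Finset (Fin d)} (hT : ∀ i ∉ T, τ i = i) (hne : T.Nonempty) :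
    0 < cycleWeight (tropLinearPart f) τ T := by
  by_contra hW
  rw [not_lt] at hW
  obtain ⟨Q, hQ, hQc⟩ := hgen
  have hcard : ∀ S : Finset (Fin d), S.card ≤ d := fun S => by simpa using Finset.card_le_univ S
  -- A negative cycle system anywhere gives exponential escape. Otherwise nonstrict potentials exist
  -- and provide the stable polydiscs for the borderline case.
  by_cases hneg : ∃ (τ' : Equiv.Perm (Fin d)) (T' : Finset (Fin d)), (∀ i ∉ T', τ' i = i) ∧
      cycleWeight (tropLinearPart f) τ' T' < 0
  · obtain ⟨τ', T', hT', hW'⟩ := hneg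
    have hne' : T'.Nonempty := by
      rw [Finset.nonempty_iff_ne_empty]
      rintro rfl
      simp [cycleWeight] at hW'
    obtain ⟨F, hF, hFQ, hFχ⟩ := exists_generic_lift hf hval hQ hT' hW'.ne_top
    exact not_isContracting_of_charpoly_neg (hF.coeff_zero hf) (Finset.card_pos.2 hne') (hcard T')
      (hFχ.trans_lt hW') (hQc F hF hFQ)
  · push Not at hneg
    obtain ⟨p, hp⟩ := exists_potential (tropLinearPart f) hneg
    obtain ⟨F, hF, hFQ, hFχ⟩ := exists_generic_lift hf hval hQ hT
      (ne_top_of_le_ne_top WithTop.zero_ne_top hW)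
    obtain ⟨t₀, ht₀⟩ := term_ge_of_potential (ε := 0) hf (by simpa using hp)
    obtain ⟨a, ha⟩ := IsLift.exists_isDegreeBounded (K := K) (ν := ν) hf
    refine not_isContracting_of_charpoly_nonpos (hF.coeff_zero hf) (Finset.card_pos.2 hne) (hcard T)
      (hFχ.trans hW) (p := p) (t := max t₀ (a + 1 + ∑ i, |p i|)) (fun r hr w hw => ?_) (hQc F hF hFQ)
    have hpr : ∀ i, a + 1 ≤ p i + r := fun i => by
      have h1 := neg_abs_le (p i)
      have h2 : |p i| ≤ ∑ i, |p i| :=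
        Finset.single_le_sum (f := fun i => |p i|) (fun i _ => abs_nonneg _) (Finset.mem_univ i)
      have h3 := (le_max_right t₀ (a + 1 + ∑ i, |p i|)).trans hr.le
      linarith
    obtain ⟨w', hw'⟩ := BerkovichAffine.exists_mapsTo (ha F hF) w
      fun i => le_trans (by exact_mod_cast hpr i) (hw i)
    refine ⟨w', hw', fun i => hw'.le_val_X fun I => ?_⟩
    rw [(hF i).2]
    have := ht₀ r ((le_max_left _ _).trans hr.le) (fun j => w.val (MvPolynomial.X j)) hw i I
    rwa [add_zero] at this

end Noncontracting

theorem mainTheorem10 {K : Type*} [Field K] (ν : AddValuation K (WithTop ℝ))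
    [Infinite (IsLocalRing.ResidueField ν.toValuation.valuationSubring)]
    {d : ℕ} (f : Fin d → TropSeries d) (hf : IsConvergentTropGerm f)
    (hval : ∀ i I, f i I ∈ Set.range ν) :
    List.TFAE [
      IsContractingTropGerm f,
      ∀ l : WithTop ℝ, IsTropEigenvalue (tropLinearPart f) l → 0 < l,
      ForGenericLifts ν f (IsContractingAnalyticGerm ν),
      ∀ F : Fin d → MvPowerSeries (Fin d) K, IsLift ν f F → IsContractingAnalyticGerm ν F] := by
  rw [tropEigenvalues_pos_iff]
  tfae_have 1 → 2 := fun h τ T hT hne => cycleWeight_pos_of_isContractingTropGerm h hT hne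
  tfae_have 2 → 1 := fun h => by
    obtain ⟨p, ε, hε, hp⟩ := exists_strict_potential (tropLinearPart f) h
    exact isContractingTropGerm_of_potential hf hε hp
  tfae_have 2 → 4 := fun h F hF => by
    obtain ⟨p, ε, hε, hp⟩ := exists_strict_potential (tropLinearPart f) h
    exact hF.isContractingAnalyticGerm_of_potential hf hε hp
  tfae_have 4 → 3 := fun h => ⟨1, one_ne_zero, fun F hF _ => h F hF⟩
  tfae_have 3 → 2 := fun h τ T hT hne => cycleWeight_pos_of_forGenericLifts hf hval h hT hne
  tfae_finish
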